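/- For $p=(x,y)\in\mathbb{R}^2\setminus\{0\}$ let $K(x,y)=\frac{xy}{2\pi(x^2+y^2)^2}$, and for a Schwartz function $f\in\mathcal{S}(\mathbb{R}^2)$ let $$R_{12}f(p)=\lim_{\epsilon\to0^+}\int_{|p-q|>\epsilon}K(p-q)f(q)\,dq$$ be the double Riesz transform with kernel $K$; this limit exists for every $f\in\mathcal{S}(\mathbb{R}^2)$ and every $p\in\mathbb{R}^2$. Then there is a sequence of Schwartz functions $g_n\in\mathcal{S}(\mathbb{R}^2)$, $n\in\mathbb{N}$, such that $$\sup_n\bigl\|\,\|e^{x^2+y^2}g_n(x,y)\|_{L^\infty_y}\bigr\|_{L^\infty_x}<\infty,\qquad \bigl\|\,\|R_{12}g_n(x,y)\|_{L^2_x}\bigr\|_{L^\infty_y}<\infty\ \text{ for every } n,\qquad \bigl\|\,\|R_{12}g_n(x,y)\|_{L^2_x}\bigr\|_{L^\infty_y}\to\infty\ \text{ as } n\to\infty.$$ Moreover, the $g_n$ can be taken of the following form, for some $A\in[3,100]$: $$g_n(x,y)=\sum_{j=100}^{n}\chi_1^{(j)}(y)\,e^{-x^2}\,\mathcal{F}^{-1}\bigl(\chi_3^{(j)}\bigr)(x),\qquad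 \chi_3^{(j)}(\xi)=\chi(\xi-2^j)+\chi(-\xi-2^j),$$ (an empty sum being $0$), where $\mathcal{F}^{-1}(\varphi)(x)=\frac{1}{\sqrt{2\pi}}\int_{\mathbb{R}} e^{ix\xi}\varphi(\xi)\,d\xi$, $\chi:\mathbb{R}\to[0,1]$ is smooth, supported on $[0,A]$ and equal to $1$ on $[\frac14,A-\frac14]$, and each $\chi_1^{(j)}:\mathbb{R}\to[0,1]$ is smooth, supported on $[2^{-j},2^{-j+1}]$ and equal to $1$ on $[2^{-j}+2^{-j-10},\,2^{-j+1}-2^{-j-10}]$. Consequently there is no constant $C<\infty$ such that $\bigl\|\,\|R_{12}f\|_{L^2_x}\bigr\|_{L^\infty_y}\le C\bigl\|\,\|e^{x^2+y^2}f\|_{L^\infty_y}\bigr\|_{L^\infty_x}$ for all $f\in\mathcal{S}(\mathbb{R}^2)$, and no constant $C<\infty$ such that $\bigl\|\,\|R_{12}f\|_{L^2_x}\bigr\|_{L^\infty_y}\le C\bigl\|\,\|f\|_{L^\infty_y}\bigr\|_{L^2_x}$ for all $f\in\mathcal{S}(\mathbb{R}^2)$. -/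

import Mathlib

open MeasureTheory Filter Topology
open scoped ENNReal NNReal SchwartzMap

noncomputable section

namespace DoubleRiesz

/-- The kernel `K(x, y) = x y / (2 π (x² + y²)²)`. -/
def kernel (p : ℝ × ℝ) : ℝ :=
  p.1 * p.2 / (2 * Real.pi * (p.1 ^ 2 + p.2 ^ 2) ^ 2)

/-- The truncated integral of `K(p - q) f(q)` over `|p - q| > ε`, where `|·|` is the Euclidean
norm of the plane (the norm of `ℝ × ℝ` is the sup norm, so the condition is written out). -/
def truncated (f : ℝ × ℝ → ℂ) (ε : ℝ) (p : ℝ × ℝ) : ℂ :=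
  ∫ q in {q : ℝ × ℝ | ε < Real.sqrt ((p.1 - q.1) ^ 2 + (p.2 - q.2) ^ 2)},
    (kernel (p - q) : ℂ) * f q

/-- The double Riesz transform: the limit of the truncated integrals as `ε → 0+`. -/
def R₁₂ (f : ℝ × ℝ → ℂ) (p : ℝ × ℝ) : ℂ :=
  limUnder (𝓝[>] (0 : ℝ)) fun ε => truncated f ε p

/-- The mixed norm `‖ ‖F(x, y)‖_{L^p_x} ‖_{L^q_y}` (inner norm in `x`, outer norm in `y`). -/
def normXthenY (p q : ℝ≥0∞) (F : ℝ × ℝ → ℂ) : ℝ≥0∞ :=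
  eLpNorm (fun y : ℝ => eLpNorm (fun x : ℝ => F (x, y)) p volume) q volume

/-- The mixed norm `‖ ‖F(x, y)‖_{L^p_y} ‖_{L^q_x}` (inner norm in `y`, outer norm in `x`). -/
def normYthenX (p q : ℝ≥0∞) (F : ℝ × ℝ → ℂ) : ℝ≥0∞ :=
  eLpNorm (fun x : ℝ => eLpNorm (fun y : ℝ => F (x, y)) p volume) q volume

/-- The function `e^{x² + y²} f(x, y)`. -/
def gaussWeighted (f : ℝ × ℝ → ℂ) (p : ℝ × ℝ) : ℂ :=
  (Real.exp (p.1 ^ 2 + p.2 ^ 2) : ℂ) * f p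

/-- `φ` is a smooth bump function with values in `[0, 1]`, supported on `[a, b]` and equal to `1`
on `[c, d]`. -/
def IsBump (φ : ℝ → ℝ) (a b c d : ℝ) : Prop :=
  ContDiff ℝ (⊤ : ℕ∞) φ ∧ (∀ t, φ t ∈ Set.Icc (0 : ℝ) 1) ∧ Function.support φ ⊆ Set.Icc a b ∧
    ∀ t ∈ Set.Icc c d, φ t = 1

/-- The one-dimensional inverse Fourier transform `(2π)^{-1/2} ∫ e^{i x ξ} φ(ξ) dξ`. -/
def invFourier (φ : ℝ → ℝ) (x : ℝ) : ℂ :=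
  ((Real.sqrt (2 * Real.pi))⁻¹ : ℝ) *
    ∫ ξ : ℝ, Complex.exp (Complex.I * (x : ℂ) * (ξ : ℂ)) * (φ ξ : ℂ)

/-- The frequency cutoff at `ξ ~ ±2^j` made from translates of `χ` and of its reflection. -/
def freqCutoff (χ : ℝ → ℝ) (j : ℕ) (ξ : ℝ) : ℝ :=
  χ (ξ - 2 ^ j) + χ (-ξ - 2 ^ j)

/-- The tensor bump `ψ(y) e^{-x²} 𝓕⁻¹(freqCutoff χ j)(x)`. -/
def tensorBump (χ ψ : ℝ → ℝ) (j : ℕ) (p : ℝ × ℝ) : ℂ :=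
  (ψ p.2 : ℂ) * (Real.exp (-p.1 ^ 2) : ℂ) * invFourier (freqCutoff χ j) p.1

end DoubleRiesz

end

/-!
Below the support of `f(x, y) = ψ(y) a(x)`, that is at a height `y < 0`, the kernel is a Fourier
integral in the first variable, and `R₁₂ f(·, y)` is a constant multiple of the Fourier transform of
`σ e^{2πy|σ|} · ℒψ(2π|σ|) · 𝓕⁻¹a(σ)`, where `ℒ` is the Laplace transform. For the tensor bumps all
three factors are nonnegative at `σ > 0`, so nothing cancels in the sum over `j`. The `j`-th term is
bounded below, uniformly in `j` and `-2^{-j} ≤ y < 0`, on a frequency band of fixed length near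
`2^j`. By Plancherel the `L²_x` norm of `R₁₂ gₙ` at small negative heights is at least a multiple of
`√n`, whereas the disjointness of the shells keeps the weighted supremum of `gₙ` bounded.
-/

noncomputable section

namespace DoubleRiesz

open scoped FourierTransform

/-! ### Existence and decay of the principal value -/

/-- The Cauchy weight `1 / (1 + t²)`, in which decay is measured throughout. -/
def cauchyWeight (t : ℝ) : ℝ := (1 + t ^ 2)⁻¹

lemma cauchyWeight_pos (t : ℝ) : 0 < cauchyWeight t := by
  unfold cauchyWeight; positivity

lemma cauchyWeight_le_one (t : ℝ) : cauchyWeight t ≤ 1 :=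
  inv_le_one_of_one_le₀ (le_add_of_nonneg_right (sq_nonneg t))

@[fun_prop]
lemma continuous_cauchyWeight : Continuous cauchyWeight :=
  Continuous.inv₀ (by fun_prop) fun t => by positivity

lemma integrable_cauchyWeight : Integrable cauchyWeight := integrable_inv_one_add_sq

lemma memLp_two_cauchyWeight : MemLp cauchyWeight 2 := by
  rw [memLp_two_iff_integrable_sq continuous_cauchyWeight.aestronglyMeasurable]
  refine integrable_cauchyWeight.mono' (by fun_prop) (.of_forall fun t => ?_)
  rw [Real.norm_of_nonneg (sq_nonneg _)]
  exact pow_le_of_le_one (cauchyWeight_pos t).le (cauchyWeight_le_one t) two_ne_zero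

lemma cauchyWeight_mul_cauchyWeight_sub_le (x t : ℝ) :
    cauchyWeight t * cauchyWeight (x - t) ≤ 2 * cauchyWeight x := by
  unfold cauchyWeight
  rw [← mul_inv, ← div_eq_mul_inv, inv_eq_one_div, div_le_div_iff₀ (by positivity) (by positivity)]
  nlinarith [sq_nonneg (x - 2 * t), sq_nonneg (t * (x - t))]

lemma cauchyWeight_le_of_abs_sub_le_one {x t : ℝ} (ht : |t - x| ≤ 1) :
    cauchyWeight t ≤ 4 * cauchyWeight x := by
  have hsq : (t - x) ^ 2 ≤ 1 := (sq_le_one_iff_abs_le_one _).2 ht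
  unfold cauchyWeight
  rw [← div_eq_mul_inv, inv_eq_one_div, div_le_div_iff₀ (by positivity) (by positivity)]
  nlinarith [sq_nonneg (2 * t - x)]

/-- The product of the Cauchy weights of the two coordinates, an integrable weight on the plane. -/
def planeWeight (z : ℝ × ℝ) : ℝ := cauchyWeight z.1 * cauchyWeight z.2

lemma planeWeight_pos (z : ℝ × ℝ) : 0 < planeWeight z :=
  mul_pos (cauchyWeight_pos _) (cauchyWeight_pos _)

lemma integrable_planeWeight : Integrable planeWeight :=
  integrable_cauchyWeight.mul_prod integrable_cauchyWeight

@[fun_prop]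
lemma measurable_kernel : Measurable kernel := by
  unfold kernel; fun_prop

/-- The reflection `(x, y) ↦ (-x, y)`, under which the kernel is odd. -/
def reflectFst : ℝ × ℝ ≃ᵐ ℝ × ℝ :=
  (MeasurableEquiv.neg ℝ).prodCongr (MeasurableEquiv.refl ℝ)

lemma reflectFst_apply (q : ℝ × ℝ) : reflectFst q = (-q.1, q.2) := rfl

lemma norm_reflectFst (q : ℝ × ℝ) : ‖reflectFst q‖ = ‖q‖ := by
  simp [reflectFst_apply, Prod.norm_def]

lemma measurePreserving_reflectFst : MeasurePreserving reflectFst volume volume :=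
  (Measure.measurePreserving_neg (volume : Measure ℝ)).prod (MeasurePreserving.id volume)

lemma kernel_reflectFst (q : ℝ × ℝ) : kernel (reflectFst q) = -kernel q := by
  simp [reflectFst_apply, kernel, neg_div]

lemma abs_kernel_le (q : ℝ × ℝ) : |kernel q| ≤ (q.1 ^ 2 + q.2 ^ 2)⁻¹ := by
  unfold kernel
  rcases eq_or_lt_of_le (show 0 ≤ q.1 ^ 2 + q.2 ^ 2 by positivity) with h | h
  · simp [← h]
  have hamgm : |q.1 * q.2| ≤ q.1 ^ 2 + q.2 ^ 2 := by
    rw [abs_le]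
    constructor <;> nlinarith [sq_nonneg (q.1 - q.2), sq_nonneg (q.1 + q.2)]
  have hden : (q.1 ^ 2 + q.2 ^ 2) ^ 2 ≤ 2 * Real.pi * (q.1 ^ 2 + q.2 ^ 2) ^ 2 :=
    le_mul_of_one_le_left (sq_nonneg _) (by linarith [Real.pi_gt_three])
  rw [abs_div, abs_of_pos (a := 2 * Real.pi * _) (by positivity)]
  calc |q.1 * q.2| / (2 * Real.pi * (q.1 ^ 2 + q.2 ^ 2) ^ 2)
      ≤ (q.1 ^ 2 + q.2 ^ 2) / (q.1 ^ 2 + q.2 ^ 2) ^ 2 := by gcongr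
    _ = (q.1 ^ 2 + q.2 ^ 2)⁻¹ := by field_simp

lemma norm_sq_le_sq_add_sq (q : ℝ × ℝ) : ‖q‖ ^ 2 ≤ q.1 ^ 2 + q.2 ^ 2 := by
  rw [Prod.norm_def, ← sq_abs q.1, ← sq_abs q.2, ← Real.norm_eq_abs, ← Real.norm_eq_abs]
  rcases max_choice ‖q.1‖ ‖q.2‖ with h | h <;> rw [h]
  · exact le_add_of_nonneg_right (sq_nonneg _)
  · exact le_add_of_nonneg_left (sq_nonneg _)

lemma abs_kernel_mul_abs_fst_le (q : ℝ × ℝ) : |kernel q| * |q.1| ≤ ‖q‖⁻¹ := by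
  rcases eq_or_ne q 0 with rfl | hq
  · simp
  have hpos := norm_pos_iff.2 hq
  calc |kernel q| * |q.1| ≤ (‖q‖ ^ 2)⁻¹ * ‖q‖ := by
        gcongr
        · refine (abs_kernel_le q).trans ?_
          gcongr
          exact norm_sq_le_sq_add_sq q
        · exact norm_fst_le q
    _ = ‖q‖⁻¹ := by rw [sq, mul_inv, inv_mul_cancel_right₀ hpos.ne']

lemma abs_kernel_le_cauchyWeight {q : ℝ × ℝ} (hq : 1 ≤ ‖q‖) :
    |kernel q| ≤ 2 * cauchyWeight q.1 := by
  have hq' : 1 ≤ q.1 ^ 2 + q.2 ^ 2 := (one_le_pow₀ hq).trans (norm_sq_le_sq_add_sq q)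
  refine (abs_kernel_le q).trans ?_
  unfold cauchyWeight
  rw [← div_eq_mul_inv, inv_eq_one_div, div_le_div_iff₀ (by positivity) (by positivity)]
  nlinarith [sq_nonneg q.2]

lemma integrableOn_inv_norm_ball (r : ℝ) :
    IntegrableOn (fun q : ℝ × ℝ => ‖q‖⁻¹) (Metric.ball 0 r) := by
  rw [integrableOn_fun_norm_addHaar volume (f := fun t => t⁻¹)]
  refine (integrableOn_const (C := (1 : ℝ)) measure_Ioo_lt_top.ne).congr_fun (fun t ht => ?_)
    measurableSet_Ioo
  simp [ht.1.ne']

/-- The complement of the closed Euclidean disc of radius `ε`. -/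
def discCompl (ε : ℝ) : Set (ℝ × ℝ) := {q | ε < √(q.1 ^ 2 + q.2 ^ 2)}

lemma measurableSet_discCompl (ε : ℝ) : MeasurableSet (discCompl ε) :=
  measurableSet_lt measurable_const (by fun_prop)

lemma tendsto_setIntegral_discCompl {E : Type*} [NormedAddCommGroup E] [NormedSpace ℝ E]
    {h : ℝ × ℝ → E} (hh : Integrable h) :
    Tendsto (fun ε => ∫ q in discCompl ε, h q) (𝓝[>] 0) (𝓝 (∫ q, h q)) := by
  simp_rw [← integral_indicator (measurableSet_discCompl _)]
  refine tendsto_integral_filter_of_dominated_convergence (fun q => ‖h q‖)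
    (.of_forall fun ε => hh.aestronglyMeasurable.indicator (measurableSet_discCompl ε))
    (.of_forall fun ε => .of_forall fun q => norm_indicator_le_norm_self _ _) hh.norm ?_
  filter_upwards [compl_mem_ae_iff.2 (measure_singleton (0 : ℝ × ℝ))] with q hq
  have hpos : 0 < √(q.1 ^ 2 + q.2 ^ 2) :=
    Real.sqrt_pos.2 ((pow_pos (norm_pos_iff.2 hq) 2).trans_le (norm_sq_le_sq_add_sq q))
  refine tendsto_const_nhds.congr' ?_
  filter_upwards [Ioo_mem_nhdsGT hpos] with ε hε
  rw [Set.indicator_of_mem (show q ∈ discCompl ε from hε.2)]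

lemma truncated_eq_setIntegral_discCompl (f : ℝ × ℝ → ℂ) (ε : ℝ) (p : ℝ × ℝ) :
    truncated f ε p = ∫ q in discCompl ε, (kernel q : ℂ) * f (p - q) := by
  have hm : MeasurableSet {q : ℝ × ℝ | ε < √((p.1 - q.1) ^ 2 + (p.2 - q.2) ^ 2)} :=
    measurableSet_lt measurable_const (by fun_prop)
  unfold truncated
  rw [← integral_indicator hm, ← integral_indicator (measurableSet_discCompl ε),
    ← integral_sub_left_eq_self _ volume p]
  simp only [Set.indicator, discCompl, Set.mem_ofPred_eq, Prod.fst_sub, Prod.snd_sub,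
    sub_sub_cancel]
  rfl

lemma R₁₂_eq_integral {f : ℝ × ℝ → ℂ} {p : ℝ × ℝ}
    (h : Integrable fun q => (kernel (p - q) : ℂ) * f q) :
    R₁₂ f p = ∫ q, (kernel (p - q) : ℂ) * f q := by
  have h' : Integrable fun q => (kernel q : ℂ) * f (p - q) := by
    simpa using h.comp_sub_left p
  rw [← integral_sub_left_eq_self _ volume p]
  simp_rw [sub_sub_cancel]
  refine ((tendsto_setIntegral_discCompl h').congr fun ε => ?_).limUnder_eq
  rw [truncated_eq_setIntegral_discCompl]

/-- `f` and its derivative decay at infinity, quantitatively in terms of Cauchy weights. -/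
structure HasCauchyDecay (C : ℝ) (f : ℝ × ℝ → ℂ) : Prop where
  differentiable : Differentiable ℝ f
  norm_le (z : ℝ × ℝ) : ‖f z‖ ≤ C * (cauchyWeight z.1 * planeWeight z)
  norm_fderiv_le (z : ℝ × ℝ) : ‖fderiv ℝ f z‖ ≤ C * cauchyWeight z.1

lemma inv_one_add_norm_pow_le (z : ℝ × ℝ) :
    ((1 + ‖z‖) ^ 6)⁻¹ ≤ cauchyWeight z.1 * planeWeight z := by
  have hweight : ∀ t : ℝ, ‖t‖ ≤ ‖z‖ → ((1 + ‖z‖) ^ 2)⁻¹ ≤ cauchyWeight t := fun t ht => by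
    unfold cauchyWeight
    gcongr
    nlinarith [Real.norm_eq_abs t ▸ sq_abs t, norm_nonneg t, norm_nonneg z]
  calc ((1 + ‖z‖) ^ 6)⁻¹ = ((1 + ‖z‖) ^ 2)⁻¹ * (((1 + ‖z‖) ^ 2)⁻¹ * ((1 + ‖z‖) ^ 2)⁻¹) := by
        rw [← mul_inv, ← mul_inv]; ring
    _ ≤ _ := by
        have h₁ := hweight z.1 (norm_fst_le z)
        have h₂ := hweight z.2 (norm_snd_le z)
        have h₀ := (cauchyWeight_pos z.1).le
        unfold planeWeight
        gcongr

lemma exists_hasCauchyDecay (f : 𝓢(ℝ × ℝ, ℂ)) : ∃ C, HasCauchyDecay C f := by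
  set C := 2 ^ 6 * (Finset.Iic (6, 1)).sup (fun m => SchwartzMap.seminorm ℝ m.1 m.2) f
  have hiter : ∀ n ≤ 1, ∀ z, ‖iteratedFDeriv ℝ n f z‖ ≤
      C * (cauchyWeight z.1 * planeWeight z) := fun n hn z => by
    have hsemi := SchwartzMap.one_add_le_sup_seminorm_apply (𝕜 := ℝ) (m := (6, 1)) (k := 6)
      (n := n) le_rfl hn f z
    calc ‖iteratedFDeriv ℝ n f z‖ ≤ C * ((1 + ‖z‖) ^ 6)⁻¹ := by
          rw [← div_eq_mul_inv, le_div_iff₀ (by positivity), mul_comm]; exact hsemi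
      _ ≤ _ := by gcongr; exact inv_one_add_norm_pow_le z
  refine ⟨C, f.differentiable, fun z => by simpa using hiter 0 zero_le_one z, fun z => ?_⟩
  calc ‖fderiv ℝ f z‖ ≤ C * (cauchyWeight z.1 * planeWeight z) := by
        simpa [norm_iteratedFDeriv_one] using hiter 1 le_rfl z
    _ ≤ C * (cauchyWeight z.1 * 1) := by
        have := (cauchyWeight_pos z.1).le
        gcongr
        exact mul_le_one₀ (cauchyWeight_le_one _) (cauchyWeight_pos _).le (cauchyWeight_le_one _)
    _ = C * cauchyWeight z.1 := by rw [mul_one]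

/-- The integrand of the principal value, antisymmetrized in the first coordinate. -/
def symmIntegrand (f : ℝ × ℝ → ℂ) (p q : ℝ × ℝ) : ℂ :=
  (kernel q : ℂ) * (f (p - q) - f (p - reflectFst q))

/-- An integrable majorant of `symmIntegrand f p`, up to a multiple of `cauchyWeight p.1`. -/
def symmMajorant (p q : ℝ × ℝ) : ℝ :=
  (Metric.ball 0 1).indicator (fun q => ‖q‖⁻¹) q +
    (planeWeight (p - q) + planeWeight (p - reflectFst q))

lemma integrable_symmMajorant (p : ℝ × ℝ) : Integrable (symmMajorant p) := by
  have hplane := integrable_planeWeight.comp_sub_left p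
  exact ((integrable_indicator_iff measurableSet_ball).2 (integrableOn_inv_norm_ball 1)).add
    (hplane.add (measurePreserving_reflectFst.integrable_comp_of_integrable hplane))

lemma integral_symmMajorant (p : ℝ × ℝ) :
    ∫ q, symmMajorant p q =
      (∫ q in Metric.ball (0 : ℝ × ℝ) 1, ‖q‖⁻¹) + 2 * ∫ z, planeWeight z := by
  have hplane := integrable_planeWeight.comp_sub_left p
  have hrefl : Integrable fun q => planeWeight (p - reflectFst q) :=
    measurePreserving_reflectFst.integrable_comp_of_integrable hplane
  have hball := (integrable_indicator_iff measurableSet_ball).2 (integrableOn_inv_norm_ball 1)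
  have hsub : ∫ q, planeWeight (p - q) = ∫ z, planeWeight z :=
    integral_sub_left_eq_self planeWeight volume p
  have hsub' : ∫ q, planeWeight (p - reflectFst q) = ∫ z, planeWeight z :=
    (measurePreserving_reflectFst.integral_comp' (fun q => planeWeight (p - q))).trans hsub
  have hsum : ∫ q, (planeWeight (p - q) + planeWeight (p - reflectFst q)) =
      2 * ∫ z, planeWeight z := by
    rw [integral_add hplane hrefl, hsub, hsub', two_mul]
  calc ∫ q, symmMajorant p q = (∫ q, (Metric.ball 0 1).indicator (fun q => ‖q‖⁻¹) q) +
        ∫ q, (planeWeight (p - q) + planeWeight (p - reflectFst q)) :=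
        integral_add hball (hplane.add hrefl)
    _ = _ := by rw [integral_indicator measurableSet_ball, hsum]

namespace HasCauchyDecay

variable {C : ℝ} {f : ℝ × ℝ → ℂ}

lemma nonneg (hf : HasCauchyDecay C f) : 0 ≤ C := by
  have h := (norm_nonneg (fderiv ℝ f 0)).trans (hf.norm_fderiv_le 0)
  exact nonneg_of_mul_nonneg_left h (cauchyWeight_pos _)

lemma integrable (hf : HasCauchyDecay C f) : Integrable f := by
  refine (integrable_planeWeight.const_mul C).mono'
    hf.differentiable.continuous.aestronglyMeasurable (.of_forall fun z => (hf.norm_le z).trans ?_)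
  have := hf.nonneg
  gcongr
  exact mul_le_of_le_one_left (planeWeight_pos z).le (cauchyWeight_le_one _)

lemma integrableOn_kernel_mul (hf : HasCauchyDecay C f) {ε : ℝ} (hε : 0 < ε) (p : ℝ × ℝ) :
    IntegrableOn (fun q => (kernel q : ℂ) * f (p - q)) (discCompl ε) := by
  refine (hf.integrable.comp_sub_left p).integrableOn.bdd_mul (c := (ε ^ 2)⁻¹) (by fun_prop) ?_
  filter_upwards [ae_restrict_mem (measurableSet_discCompl ε)] with q hq
  have hle : ε ^ 2 ≤ q.1 ^ 2 + q.2 ^ 2 := ((Real.lt_sqrt hε.le).1 hq).le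
  rw [Complex.norm_real, Real.norm_eq_abs]
  refine (abs_kernel_le q).trans ?_
  gcongr

lemma truncated_eq_symmIntegrand (hf : HasCauchyDecay C f) {ε : ℝ} (hε : 0 < ε) (p : ℝ × ℝ) :
    truncated f ε p = (1 / 2 : ℂ) * ∫ q in discCompl ε, symmIntegrand f p q := by
  have hpre : reflectFst ⁻¹' discCompl ε = discCompl ε := by
    ext q; simp [discCompl, reflectFst_apply]
  have hint := hf.integrableOn_kernel_mul hε p
  have hint' : IntegrableOn (fun q => (kernel q : ℂ) * f (p - reflectFst q)) (discCompl ε) := by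
    have := (measurePreserving_reflectFst.integrableOn_comp_preimage
      reflectFst.measurableEmbedding).2 hint
    rw [hpre] at this
    simpa [Function.comp_def, kernel_reflectFst] using this.neg
  have hrefl : ∫ q in discCompl ε, (kernel q : ℂ) * f (p - reflectFst q) =
      -∫ q in discCompl ε, (kernel q : ℂ) * f (p - q) := by
    have := measurePreserving_reflectFst.setIntegral_preimage_emb
      reflectFst.measurableEmbedding (fun q => (kernel q : ℂ) * f (p - q)) (discCompl ε)
    rw [hpre] at this
    rw [← this, ← integral_neg]
    simp [kernel_reflectFst]
  simp_rw [symmIntegrand, mul_sub]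
  rw [integral_sub hint hint', hrefl, truncated_eq_setIntegral_discCompl]
  ring

lemma norm_sub_reflectFst_le (hf : HasCauchyDecay C f) {p q : ℝ × ℝ} (hq : ‖q‖ ≤ 1) :
    ‖f (p - q) - f (p - reflectFst q)‖ ≤ 8 * C * cauchyWeight p.1 * |q.1| := by
  have hstrip : Convex ℝ {z : ℝ × ℝ | |z.1 - p.1| ≤ 1} :=
    (convex_closedBall p.1 1).is_linear_preimage (LinearMap.fst ℝ ℝ ℝ).isLinear
  have hfst : |q.1| ≤ 1 := (norm_fst_le q).trans hq
  have hdist : ‖(p - q) - (p - reflectFst q)‖ = 2 * |q.1| := by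
    have : (p - q) - (p - reflectFst q) = (-(2 * q.1), 0) := by
      ext <;> simp [reflectFst_apply]; ring
    simp [this, Prod.norm_def]
  have hmvt := hstrip.norm_image_sub_le_of_norm_fderiv_le (𝕜 := ℝ) (f := f)
    (C := C * (4 * cauchyWeight p.1)) (x := p - reflectFst q) (y := p - q)
    (fun z _ => hf.differentiable z)
    (fun z hz => (hf.norm_fderiv_le z).trans
      (mul_le_mul_of_nonneg_left (cauchyWeight_le_of_abs_sub_le_one hz) hf.nonneg))
    (show |(p - reflectFst q).1 - p.1| ≤ 1 by simpa [reflectFst_apply] using hfst)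
    (show |(p - q).1 - p.1| ≤ 1 by simpa using hfst)
  rw [hdist] at hmvt
  linarith

lemma abs_kernel_mul_norm_le (hf : HasCauchyDecay C f) (p : ℝ × ℝ) {q : ℝ × ℝ} (hq : 1 ≤ ‖q‖) :
    |kernel q| * ‖f (p - q)‖ ≤ 4 * C * cauchyWeight p.1 * planeWeight (p - q) := by
  have hC := hf.nonneg
  have hw := (cauchyWeight_pos q.1).le
  have hplane := (planeWeight_pos (p - q)).le
  calc |kernel q| * ‖f (p - q)‖
      ≤ 2 * cauchyWeight q.1 * (C * (cauchyWeight (p.1 - q.1) * planeWeight (p - q))) := by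
        gcongr
        · exact abs_kernel_le_cauchyWeight hq
        · exact hf.norm_le (p - q)
    _ = 2 * C * (cauchyWeight q.1 * cauchyWeight (p.1 - q.1)) * planeWeight (p - q) := by ring
    _ ≤ 2 * C * (2 * cauchyWeight p.1) * planeWeight (p - q) := by
        gcongr ?_ * _
        exact mul_le_mul_of_nonneg_left (cauchyWeight_mul_cauchyWeight_sub_le _ _) (by positivity)
    _ = _ := by ring

lemma norm_symmIntegrand_le (hf : HasCauchyDecay C f) (p q : ℝ × ℝ) :
    ‖symmIntegrand f p q‖ ≤ 8 * C * cauchyWeight p.1 * symmMajorant p q := by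
  have hC := hf.nonneg
  have hw := (cauchyWeight_pos p.1).le
  have hplane := (planeWeight_pos (p - q)).le
  have hplane' := (planeWeight_pos (p - reflectFst q)).le
  rw [symmIntegrand, norm_mul, Complex.norm_real, Real.norm_eq_abs, symmMajorant]
  rcases lt_or_ge ‖q‖ 1 with hq | hq
  · rw [Set.indicator_of_mem (mem_ball_zero_iff.2 hq)]
    calc |kernel q| * ‖f (p - q) - f (p - reflectFst q)‖
        ≤ |kernel q| * (8 * C * cauchyWeight p.1 * |q.1|) := by
          gcongr; exact hf.norm_sub_reflectFst_le hq.le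
      _ = 8 * C * cauchyWeight p.1 * (|kernel q| * |q.1|) := by ring
      _ ≤ 8 * C * cauchyWeight p.1 * (‖q‖⁻¹ + (planeWeight (p - q) +
          planeWeight (p - reflectFst q))) := by
          gcongr
          exact (abs_kernel_mul_abs_fst_le q).trans (le_add_of_nonneg_right (by positivity))
  · have hfar := hf.abs_kernel_mul_norm_le p hq
    have hfar' := hf.abs_kernel_mul_norm_le p (hq.trans_eq (norm_reflectFst q).symm)
    rw [kernel_reflectFst, abs_neg] at hfar'
    rw [Set.indicator_of_notMem (by simpa using hq), zero_add]
    calc |kernel q| * ‖f (p - q) - f (p - reflectFst q)‖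
        ≤ |kernel q| * (‖f (p - q)‖ + ‖f (p - reflectFst q)‖) := by
          gcongr; exact norm_sub_le _ _
      _ ≤ 4 * C * cauchyWeight p.1 * (planeWeight (p - q) + planeWeight (p - reflectFst q)) := by
          linarith
      _ ≤ _ := by gcongr; norm_num

lemma integrable_symmIntegrand (hf : HasCauchyDecay C f) (p : ℝ × ℝ) :
    Integrable (symmIntegrand f p) := by
  have hm : Measurable f := hf.differentiable.continuous.measurable
  have : Measurable (symmIntegrand f p) := by unfold symmIntegrand; fun_prop
  exact ((integrable_symmMajorant p).const_mul (8 * C * cauchyWeight p.1)).mono'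
    this.aestronglyMeasurable (.of_forall (hf.norm_symmIntegrand_le p))

lemma tendsto_truncated_symmIntegrand (hf : HasCauchyDecay C f) (p : ℝ × ℝ) :
    Tendsto (fun ε => truncated f ε p) (𝓝[>] 0)
      (𝓝 ((1 / 2 : ℂ) * ∫ q, symmIntegrand f p q)) := by
  refine ((tendsto_setIntegral_discCompl (hf.integrable_symmIntegrand p)).const_mul
    (1 / 2 : ℂ)).congr' ?_
  filter_upwards [self_mem_nhdsWithin] with ε hε
  rw [hf.truncated_eq_symmIntegrand hε p]

lemma R₁₂_eq_symmIntegrand (hf : HasCauchyDecay C f) (p : ℝ × ℝ) :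
    R₁₂ f p = (1 / 2 : ℂ) * ∫ q, symmIntegrand f p q :=
  (hf.tendsto_truncated_symmIntegrand p).limUnder_eq

theorem tendsto_truncated (hf : HasCauchyDecay C f) (p : ℝ × ℝ) :
    Tendsto (fun ε => truncated f ε p) (𝓝[>] 0) (𝓝 (R₁₂ f p)) := by
  rw [hf.R₁₂_eq_symmIntegrand]
  exact hf.tendsto_truncated_symmIntegrand p

theorem norm_R₁₂_le (hf : HasCauchyDecay C f) (p : ℝ × ℝ) :
    ‖R₁₂ f p‖ ≤ 4 * C * ((∫ q in Metric.ball (0 : ℝ × ℝ) 1, ‖q‖⁻¹) + 2 * ∫ z, planeWeight z) *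
      cauchyWeight p.1 := by
  have h := norm_integral_le_of_norm_le ((integrable_symmMajorant p).const_mul
    (8 * C * cauchyWeight p.1)) (.of_forall (hf.norm_symmIntegrand_le p))
  rw [integral_const_mul, integral_symmMajorant] at h
  rw [hf.R₁₂_eq_symmIntegrand, norm_mul, show ‖(1 / 2 : ℂ)‖ = 1 / 2 by norm_num]
  linarith

end HasCauchyDecay

lemma normXthenY_top_lt_top {F : ℝ × ℝ → ℂ} {p : ℝ≥0∞} {u : ℝ → ℝ} (hu : MemLp u p)
    (hF : ∀ z, ‖F z‖ ≤ u z.1) : normXthenY p ∞ F < ∞ := by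
  refine lt_of_le_of_lt ?_ hu.2
  rw [normXthenY, eLpNorm_exponent_top]
  refine eLpNormEssSup_le_of_ae_enorm_bound (.of_forall fun y => ?_)
  rw [enorm_eq_self]
  exact eLpNorm_mono_real fun x => hF (x, y)

theorem normXthenY_two_top_R₁₂_lt_top (f : 𝓢(ℝ × ℝ, ℂ)) : normXthenY 2 ∞ (R₁₂ f) < ∞ := by
  obtain ⟨C, hf⟩ := exists_hasCauchyDecay f
  exact normXthenY_top_lt_top (memLp_two_cauchyWeight.const_mul _) hf.norm_R₁₂_le

/-! ### The tensor bumps as Schwartz functions -/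

section SchwartzTensor

variable {E F A : Type*} [NormedAddCommGroup E] [NormedAddCommGroup F]

lemma norm_pow_le_add (z : E × F) (k : ℕ) : ‖z‖ ^ k ≤ ‖z.1‖ ^ k + ‖z.2‖ ^ k := by
  rcases max_choice ‖z.1‖ ‖z.2‖ with h | h <;> rw [Prod.norm_def, h]
  · exact le_add_of_nonneg_right (by positivity)
  · exact le_add_of_nonneg_left (by positivity)

variable [NormedSpace ℝ E] [NormedSpace ℝ F]

lemma norm_iteratedFDeriv_comp_right_le {G : Type*} [NormedAddCommGroup G] [NormedSpace ℝ G]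
    {L : E →L[ℝ] F} (hL : ‖L‖ ≤ 1) {f : F → G} {i : ℕ} (hf : ContDiff ℝ i f) (z : E) :
    ‖iteratedFDeriv ℝ i (f ∘ L) z‖ ≤ ‖iteratedFDeriv ℝ i f (L z)‖ := by
  rw [L.iteratedFDeriv_comp_right hf z le_rfl]
  refine ((iteratedFDeriv ℝ i f (L z)).norm_compContinuousLinearMap_le fun _ => L).trans
    (mul_le_of_le_one_right (norm_nonneg _) ?_)
  exact Finset.prod_le_one (fun _ _ => norm_nonneg _) fun _ _ => hL

variable [NormedRing A] [NormedAlgebra ℝ A]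

lemma exists_norm_pow_mul_iteratedFDeriv_tensor_le (f : 𝓢(E, A)) (g : 𝓢(F, A)) (k i l : ℕ) :
    ∃ C : ℝ, ∀ z : E × F, ‖z‖ ^ k * (‖iteratedFDeriv ℝ i (f ∘ ContinuousLinearMap.fst ℝ E F) z‖ *
      ‖iteratedFDeriv ℝ l (g ∘ ContinuousLinearMap.snd ℝ E F) z‖) ≤ C := by
  obtain ⟨Cf₀, hCf₀, hf₀⟩ := f.decay 0 i
  obtain ⟨Cfₖ, hCfₖ, hfₖ⟩ := f.decay k i
  obtain ⟨Cg₀, -, hg₀⟩ := g.decay 0 l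
  obtain ⟨Cgₖ, -, hgₖ⟩ := g.decay k l
  simp only [pow_zero, one_mul] at hf₀ hg₀
  refine ⟨Cfₖ * Cg₀ + Cf₀ * Cgₖ, fun z => ?_⟩
  have hfst : ‖iteratedFDeriv ℝ i (f ∘ ContinuousLinearMap.fst ℝ E F) z‖ ≤
      ‖iteratedFDeriv ℝ i f z.1‖ :=
    norm_iteratedFDeriv_comp_right_le (ContinuousLinearMap.norm_fst_le ℝ E F) (f.smooth i) z
  have hsnd : ‖iteratedFDeriv ℝ l (g ∘ ContinuousLinearMap.snd ℝ E F) z‖ ≤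
      ‖iteratedFDeriv ℝ l g z.2‖ :=
    norm_iteratedFDeriv_comp_right_le (ContinuousLinearMap.norm_snd_le ℝ E F) (g.smooth l) z
  calc _ ≤ (‖z.1‖ ^ k + ‖z.2‖ ^ k) *
        (‖iteratedFDeriv ℝ i f z.1‖ * ‖iteratedFDeriv ℝ l g z.2‖) :=
        mul_le_mul (norm_pow_le_add z k)
          (mul_le_mul hfst hsnd (norm_nonneg _) (norm_nonneg _)) (by positivity) (by positivity)
    _ = (‖z.1‖ ^ k * ‖iteratedFDeriv ℝ i f z.1‖) * ‖iteratedFDeriv ℝ l g z.2‖ +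
        ‖iteratedFDeriv ℝ i f z.1‖ * (‖z.2‖ ^ k * ‖iteratedFDeriv ℝ l g z.2‖) := by ring
    _ ≤ Cfₖ * Cg₀ + Cf₀ * Cgₖ :=
        add_le_add (mul_le_mul (hfₖ z.1) (hg₀ z.2) (norm_nonneg _) hCfₖ.le)
          (mul_le_mul (hf₀ z.1) (hgₖ z.2) (by positivity) hCf₀.le)

/-- The tensor product `(x, y) ↦ f(x) g(y)` of two Schwartz functions. -/
def schwartzTensor (f : 𝓢(E, A)) (g : 𝓢(F, A)) : 𝓢(E × F, A) where
  toFun z := f z.1 * g z.2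
  smooth' := ((f.smooth ⊤).comp contDiff_fst).mul ((g.smooth ⊤).comp contDiff_snd)
  decay' k n := by
    choose C hC using exists_norm_pow_mul_iteratedFDeriv_tensor_le f g k
    refine ⟨∑ i ∈ Finset.range (n + 1), (n.choose i : ℝ) * C i (n - i), fun z => ?_⟩
    have hleibniz := norm_iteratedFDeriv_mul_le (𝕜 := ℝ)
      (f := f ∘ ContinuousLinearMap.fst ℝ E F) (g := g ∘ ContinuousLinearMap.snd ℝ E F)
      (N := (⊤ : ℕ∞)) ((f.smooth ⊤).comp (ContinuousLinearMap.contDiff _))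
      ((g.smooth ⊤).comp (ContinuousLinearMap.contDiff _)) z (n := n) (mod_cast le_top)
    refine (mul_le_mul_of_nonneg_left hleibniz (by positivity)).trans ?_
    rw [Finset.mul_sum]
    refine Finset.sum_le_sum fun i _ => ?_
    rw [mul_assoc, mul_left_comm]
    gcongr
    exact hC i (n - i) z

lemma schwartzTensor_apply (f : 𝓢(E, A)) (g : 𝓢(F, A)) (z : E × F) :
    schwartzTensor f g z = f z.1 * g z.2 := rfl

end SchwartzTensor

lemma hasTemperateGrowth_exp_neg_norm_sq {H : Type*} [NormedAddCommGroup H]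
    [InnerProductSpace ℝ H] : (fun x : H => Real.exp (-‖x‖ ^ 2)).HasTemperateGrowth := by
  have hsmooth : ContDiff ℝ (⊤ : ℕ∞) fun t : ℝ => Real.exp (-t) := by fun_prop
  -- `e^{-t}` grows exponentially at `-∞`, so its derivatives are only bounded near `t = ‖x‖² ≥ 0`
  refine Function.HasTemperateGrowth.comp' (g := fun t => Real.exp (-t)) (t := Set.Ioi (-1)) ?_
    isOpen_Ioi.uniqueDiffOn hsmooth.contDiffOn
    (fun N => ⟨0, Real.exp 1, by positivity, fun n _ t ht => ?_⟩)
    (Function.hasTemperateGrowth_norm_sq H)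
  · rintro - ⟨x, rfl⟩
    exact neg_one_lt_zero.trans_le (sq_nonneg ‖x‖)
  · have hderiv : iteratedDeriv n (fun t : ℝ => Real.exp (-t)) t = (-1) ^ n * Real.exp (-t) := by
      rw [iteratedDeriv_comp_neg n Real.exp t, iteratedDeriv_eq_iterate, Real.iter_deriv_exp,
        smul_eq_mul]
    rw [iteratedFDerivWithin_of_isOpen n isOpen_Ioi ht, norm_iteratedFDeriv_eq_norm_iteratedDeriv,
      hderiv, pow_zero, mul_one, norm_mul, norm_pow, norm_neg, norm_one, one_pow, one_mul,
      Real.norm_eq_abs, Real.abs_exp]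
    exact Real.exp_le_exp.2 (by linarith [Set.mem_Ioi.1 ht])

lemma exists_schwartz_ofReal {φ : ℝ → ℝ} (hφ : ContDiff ℝ (⊤ : ℕ∞) φ)
    (hc : HasCompactSupport φ) : ∃ f : 𝓢(ℝ, ℂ), ∀ ξ, f ξ = φ ξ :=
  ⟨(hc.comp_left Complex.ofReal_zero).toSchwartzMap (Complex.ofRealCLM.contDiff.comp hφ),
    fun _ => rfl⟩

lemma exists_schwartz_invFourier {φ : ℝ → ℝ} (hφ : ContDiff ℝ (⊤ : ℕ∞) φ)
    (hc : HasCompactSupport φ) : ∃ f : 𝓢(ℝ, ℂ), ∀ x, f x = invFourier φ x := by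
  obtain ⟨u, hu⟩ := exists_schwartz_ofReal hφ hc
  let L : ℝ ≃L[ℝ] ℝ :=
    ContinuousLinearEquiv.unitsEquivAut ℝ (Units.mk0 (2 * Real.pi)⁻¹ (by positivity))
  let v : 𝓢(ℝ, ℂ) :=
    SchwartzMap.compCLMOfContinuousLinearEquiv ℂ L (FourierTransformInv.fourierInv u)
  have hv : ∀ x, v x = ∫ ξ : ℝ, Complex.exp (Complex.I * (x : ℂ) * (ξ : ℂ)) * (φ ξ : ℂ) := by
    intro x
    have hrescale : v x = FourierTransformInv.fourierInv u (x * (2 * Real.pi)⁻¹) := rfl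
    rw [hrescale, SchwartzMap.fourierInv_coe, Real.fourierInv_eq']
    refine integral_congr_ae (.of_forall fun ξ => ?_)
    simp only [hu, smul_eq_mul, RCLike.inner_apply, conj_trivial]
    congr 2
    push_cast
    field_simp
  exact ⟨(((√(2 * Real.pi))⁻¹ : ℝ) : ℂ) • v, fun x => by
    rw [smul_apply, smul_eq_mul, hv, invFourier]⟩

lemma contDiff_freqCutoff {χ : ℝ → ℝ} {n : ℕ∞} (hχ : ContDiff ℝ n χ) (j : ℕ) :
    ContDiff ℝ n (freqCutoff χ j) := by
  unfold freqCutoff; fun_prop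

lemma hasCompactSupport_freqCutoff {χ : ℝ → ℝ} (hχ : HasCompactSupport χ) (j : ℕ) :
    HasCompactSupport (freqCutoff χ j) := by
  have hright : HasCompactSupport fun ξ : ℝ => χ (ξ - 2 ^ j) :=
    hχ.comp_homeomorph (Homeomorph.subRight ((2 : ℝ) ^ j))
  have hleft : HasCompactSupport fun ξ : ℝ => χ (-ξ - 2 ^ j) :=
    hχ.comp_homeomorph ((Homeomorph.neg ℝ).trans (Homeomorph.subRight ((2 : ℝ) ^ j)))
  exact hright.add hleft

lemma exists_schwartz_tensorBump {χ ψ : ℝ → ℝ} (hχ : ContDiff ℝ (⊤ : ℕ∞) χ)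
    (hχc : HasCompactSupport χ) (hψ : ContDiff ℝ (⊤ : ℕ∞) ψ) (hψc : HasCompactSupport ψ) (j : ℕ) :
    ∃ G : 𝓢(ℝ × ℝ, ℂ), ∀ p, G p = tensorBump χ ψ j p := by
  obtain ⟨f, hf⟩ := exists_schwartz_invFourier (contDiff_freqCutoff hχ j)
    (hasCompactSupport_freqCutoff hχc j)
  obtain ⟨w, hw⟩ := exists_schwartz_ofReal hψ hψc
  have hgauss : (fun x : ℝ => Real.exp (-x ^ 2)).HasTemperateGrowth := by
    simpa only [Real.norm_eq_abs, sq_abs] using hasTemperateGrowth_exp_neg_norm_sq (H := ℝ)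
  have hgauss' : (fun x : ℝ => (Real.exp (-x ^ 2) : ℂ)).HasTemperateGrowth :=
    Function.Complex.hasTemperateGrowth_ofReal.comp hgauss
  refine ⟨schwartzTensor (SchwartzMap.smulLeftCLM ℂ
    (fun x : ℝ => (Real.exp (-x ^ 2) : ℂ)) f) w, fun p => ?_⟩
  rw [schwartzTensor_apply, SchwartzMap.smulLeftCLM_apply_apply hgauss', hf, hw, smul_eq_mul,
    tensorBump]
  ring

/-! ### The Fourier transform of integrable functions -/

section Plancherel

variable {V H : Type*} [NormedAddCommGroup V] [InnerProductSpace ℝ V] [FiniteDimensional ℝ V]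
  [MeasurableSpace V] [BorelSpace V] [NormedAddCommGroup H] [InnerProductSpace ℂ H]

lemma continuous_fourier {f : V → H} (hf : Integrable f) : Continuous (𝓕 f) :=
  VectorFourier.fourierIntegral_continuous Real.continuous_fourierChar continuous_inner hf

lemma norm_fourier_le (f : V → H) (w : V) : ‖𝓕 f w‖ ≤ ∫ v, ‖f v‖ :=
  VectorFourier.norm_fourierIntegral_le_integral_norm Real.fourierChar volume (innerₗ V) f w

variable [CompleteSpace H]

lemma integral_schwartz_smul_fourier (g : 𝓢(V, ℂ)) {f : V → H} (hf : Integrable f) :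
    ∫ v, 𝓕 g v • f v = ∫ v, g v • 𝓕 f v := by
  rw [SchwartzMap.fourier_coe]
  exact (VectorFourier.integral_fourierIntegral_smul_eq_flip (L := innerₗ V)
    Real.continuous_fourierChar continuous_inner g.integrable hf).trans (by rw [flip_innerₗ]; rfl)

lemma fourier_toLp_ae_eq {f : V → H} (hf : Integrable f) (hf₂ : MemLp f 2) :
    (𝓕 hf₂.toLp : Lp H 2) =ᵐ[volume] 𝓕 f := by
  refine ae_eq_of_integral_contDiff_smul_eq ((Lp.memLp _).locallyIntegrable one_le_two)
    (continuous_fourier hf).locallyIntegrable fun g hg hgc => ?_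
  let g' : 𝓢(V, ℂ) := (hgc.comp_left Complex.ofReal_zero).toSchwartzMap
    (Complex.ofRealCLM.contDiff.comp hg)
  have hreal : ∀ u : V → H, ∫ v, g v • u v = ∫ v, g' v • u v := fun u =>
    integral_congr_ae (.of_forall fun v => (Complex.coe_smul (g v) (u v)).symm)
  have hdistr := congrArg (· g') (Lp.fourier_toTemperedDistribution_eq hf₂.toLp)
  simp only [TemperedDistribution.fourier_apply, Lp.toTemperedDistribution_apply] at hdistr
  rw [hreal, hreal, ← hdistr, ← integral_schwartz_smul_fourier g' hf]
  refine integral_congr_ae ?_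
  filter_upwards [hf₂.coeFn_toLp] with v hv
  rw [hv]

theorem eLpNorm_two_fourier {f : V → H} (hf : Integrable f) (hf₂ : MemLp f 2) :
    eLpNorm (𝓕 f) 2 = eLpNorm f 2 := by
  rw [← eLpNorm_congr_ae (fourier_toLp_ae_eq hf hf₂), ← eLpNorm_congr_ae hf₂.coeFn_toLp,
    ← Lp.enorm_def, ← Lp.enorm_def, ← ofReal_norm, ← ofReal_norm, Lp.norm_fourier_eq]

end Plancherel

/-! ### The kernel as a Fourier integral -/

section Fubini

variable {X Y : Type*} [MeasurableSpace X] [MeasurableSpace Y] {μ : Measure X} {ν : Measure Y}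
  [SFinite μ] [SFinite ν]

lemma integral_mul_integral_comm {f : X → ℂ} {g : Y → ℂ} (hf : Integrable f μ)
    (hg : Integrable g ν) {k : X → Y → ℂ} (hk : Measurable (Function.uncurry k)) {C : ℝ}
    (hC : ∀ x y, f x ≠ 0 → ‖k x y‖ ≤ C) :
    ∫ x, f x * ∫ y, k x y * g y ∂ν ∂μ = ∫ y, g y * ∫ x, k x y * f x ∂μ ∂ν := by
  have hfg := hf.mul_prod hg
  have hint : Integrable (fun z : X × Y => f z.1 * (k z.1 z.2 * g z.2)) (μ.prod ν) := by
    refine (hfg.norm.const_mul C).mono' ?_ (.of_forall fun z => ?_)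
    · exact hf.1.comp_fst.mul (hk.aestronglyMeasurable.mul hg.1.comp_snd)
    · by_cases hz : f z.1 = 0
      · simp [hz]
      · rw [norm_mul, norm_mul, norm_mul, mul_left_comm]
        exact mul_le_mul_of_nonneg_right (hC z.1 z.2 hz) (by positivity)
  simp only [← integral_const_mul]
  rw [integral_integral_swap hint]
  exact integral_congr_ae (.of_forall fun y => integral_congr_ae (.of_forall fun x => by ring))

end Fubini

section DampedLinear

/-- The function `σ e^{-b|σ|}`, whose Fourier transform is a multiple of the restriction of the
kernel to a horizontal line. -/
def dampedLinear (b σ : ℝ) : ℝ := σ * Real.exp (-(b * |σ|))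

@[fun_prop]
lemma continuous_dampedLinear (b : ℝ) : Continuous (dampedLinear b) := by
  unfold dampedLinear; fun_prop

lemma abs_dampedLinear_le {b : ℝ} (hb : 0 < b) (σ : ℝ) :
    |dampedLinear b σ| ≤ (1 / b + 6 / b ^ 3) * cauchyWeight σ := by
  have hfirst := Real.pow_div_factorial_le_exp (b * |σ|) (by positivity) 1
  have hthird := Real.pow_div_factorial_le_exp (b * |σ|) (by positivity) 3
  simp only [pow_one, Nat.factorial, mul_one, Nat.cast_one, div_one, mul_pow] at hfirst hthird
  rw [dampedLinear, abs_mul, Real.abs_exp, Real.exp_neg, cauchyWeight, ← div_eq_mul_inv,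
    ← div_eq_mul_inv, div_le_div_iff₀ (Real.exp_pos _) (by positivity)]
  calc |σ| * (1 + σ ^ 2) = 1 / b * (b * |σ|) + 6 / b ^ 3 * (b ^ 3 * |σ| ^ 3 / 6) := by
        rw [← sq_abs σ]; field_simp
    _ ≤ 1 / b * Real.exp (b * |σ|) + 6 / b ^ 3 * Real.exp (b * |σ|) := by
        gcongr
        exact_mod_cast hthird
    _ = _ := by ring

lemma integrable_dampedLinear {b : ℝ} (hb : 0 < b) : Integrable (dampedLinear b) :=
  (integrable_cauchyWeight.const_mul _).mono' (continuous_dampedLinear b).aestronglyMeasurable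
    (.of_forall (abs_dampedLinear_le hb))

lemma memLp_two_dampedLinear {b : ℝ} (hb : 0 < b) : MemLp (dampedLinear b) 2 :=
  (memLp_two_cauchyWeight.const_mul _).mono' (continuous_dampedLinear b).aestronglyMeasurable
    (.of_forall (abs_dampedLinear_le hb))

lemma norm_exp_neg_mul_ofReal (r : ℂ) (σ : ℝ) :
    ‖Complex.exp (-(r * σ))‖ = Real.exp (-(r.re * σ)) := by
  rw [Complex.norm_exp, Complex.neg_re, Complex.re_mul_ofReal]

lemma norm_mul_exp_neg_mul {r : ℂ} {σ : ℝ} (hσ : 0 < σ) :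
    ‖(σ : ℂ) * Complex.exp (-(r * σ))‖ = dampedLinear r.re σ := by
  rw [norm_mul, norm_exp_neg_mul_ofReal, Complex.norm_of_nonneg hσ.le, dampedLinear, abs_of_pos hσ]

lemma integrableOn_mul_exp_neg_mul {r : ℂ} (hr : 0 < r.re) :
    IntegrableOn (fun σ : ℝ => (σ : ℂ) * Complex.exp (-(r * σ))) (Set.Ioi 0) := by
  refine (integrable_dampedLinear hr).integrableOn.mono'
    (by fun_prop : Continuous _).aestronglyMeasurable ?_
  filter_upwards [ae_restrict_mem measurableSet_Ioi] with σ hσ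
  exact (norm_mul_exp_neg_mul hσ).le

lemma hasDerivAt_exp_neg_mul (r : ℂ) (σ : ℝ) :
    HasDerivAt (fun σ : ℝ => Complex.exp (-(r * σ))) (-r * Complex.exp (-(r * σ))) σ := by
  have hlin : HasDerivAt (fun σ : ℝ => -(r * σ)) (-(r * 1)) σ :=
    ((Complex.ofRealCLM.hasDerivAt (x := σ)).const_mul r).fun_neg
  simpa only [mul_one, mul_comm] using hlin.cexp

lemma tendsto_exp_neg_mul_atTop {r : ℂ} (hr : 0 < r.re) :
    Tendsto (fun σ : ℝ => Complex.exp (-(r * σ))) atTop (𝓝 0) := by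
  refine tendsto_zero_iff_norm_tendsto_zero.2
    ((tendsto_rpow_mul_exp_neg_mul_atTop_nhds_zero 0 r.re hr).congr fun σ => ?_)
  rw [norm_exp_neg_mul_ofReal, Real.rpow_zero, one_mul, neg_mul]

lemma tendsto_mul_exp_neg_mul_atTop {r : ℂ} (hr : 0 < r.re) :
    Tendsto (fun σ : ℝ => (σ : ℂ) * Complex.exp (-(r * σ))) atTop (𝓝 0) := by
  refine tendsto_zero_iff_norm_tendsto_zero.2
    ((tendsto_rpow_mul_exp_neg_mul_atTop_nhds_zero 1 r.re hr).congr' ?_)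
  filter_upwards [eventually_gt_atTop 0] with σ hσ
  rw [norm_mul_exp_neg_mul hσ, dampedLinear, abs_of_pos hσ, Real.rpow_one, neg_mul]

lemma integral_Ioi_mul_exp_neg_mul {r : ℂ} (hr : 0 < r.re) :
    ∫ σ in Set.Ioi (0 : ℝ), (σ : ℂ) * Complex.exp (-(r * σ)) = 1 / r ^ 2 := by
  have hr₀ : r ≠ 0 := fun h => hr.ne' (congrArg Complex.re h)
  have hderiv : ∀ σ : ℝ, HasDerivAt
      (fun σ : ℝ => -(1 / r * (σ * Complex.exp (-(r * σ))) + 1 / r ^ 2 * Complex.exp (-(r * σ))))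
      (σ * Complex.exp (-(r * σ))) σ := fun σ => by
    have hexp := hasDerivAt_exp_neg_mul r σ
    have hmul := (Complex.ofRealCLM.hasDerivAt (x := σ)).fun_mul hexp
    convert! ((hmul.const_mul (1 / r)).add (hexp.const_mul (1 / r ^ 2))).fun_neg using 1
    simp only [Complex.ofRealCLM_apply, Complex.ofReal_one]
    field_simp
    ring
  have hlim := (((tendsto_mul_exp_neg_mul_atTop hr).const_mul (1 / r)).add
    ((tendsto_exp_neg_mul_atTop hr).const_mul (1 / r ^ 2))).neg
  rw [integral_Ioi_of_hasDerivAt_of_tendsto' (fun σ _ => hderiv σ)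
    (integrableOn_mul_exp_neg_mul hr) hlim]
  simp

lemma fourier_dampedLinear {b : ℝ} (hb : 0 < b) (u : ℝ) :
    𝓕 (fun σ => (dampedLinear b σ : ℂ)) u =
      1 / (b + 2 * Real.pi * u * Complex.I) ^ 2 - 1 / (b - 2 * Real.pi * u * Complex.I) ^ 2 := by
  set f : ℝ → ℂ := fun σ =>
    Complex.exp (↑(-2 * Real.pi * σ * u) * Complex.I) • (dampedLinear b σ : ℂ)
  have hf : Integrable f := by
    refine (integrable_dampedLinear hb).norm.mono'
      (by fun_prop : Continuous f).aestronglyMeasurable (.of_forall fun σ => ?_)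
    rw [norm_smul, Complex.norm_exp_ofReal_mul_I, one_mul, Complex.norm_real]
  have hright : ∫ σ in Set.Ioi 0, f σ = 1 / (b + 2 * Real.pi * u * Complex.I) ^ 2 := by
    rw [← integral_Ioi_mul_exp_neg_mul (by simpa using hb)]
    refine setIntegral_congr_fun measurableSet_Ioi fun σ hσ => ?_
    simp only [f, dampedLinear, abs_of_pos (Set.mem_Ioi.1 hσ), smul_eq_mul]
    push_cast
    rw [mul_left_comm, ← Complex.exp_add]
    congr 2
    ring
  have hleft : ∫ σ in Set.Iic 0, f σ = -(1 / (b - 2 * Real.pi * u * Complex.I) ^ 2) := by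
    have hreflect := integral_comp_neg_Ioi 0 f
    rw [neg_zero] at hreflect
    rw [← hreflect, ← integral_Ioi_mul_exp_neg_mul (by simpa using hb), ← integral_neg]
    refine setIntegral_congr_fun measurableSet_Ioi fun σ hσ => ?_
    simp only [f, dampedLinear, abs_neg, abs_of_pos (Set.mem_Ioi.1 hσ), smul_eq_mul]
    push_cast
    rw [mul_left_comm, ← Complex.exp_add, neg_mul]
    congr 3
    ring
  rw [Real.fourier_real_eq_integral_exp_smul, ← intervalIntegral.integral_Iic_add_Ioi
    hf.integrableOn hf.integrableOn, hleft, hright]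
  ring

lemma kernel_eq_fourier_dampedLinear (u : ℝ) {Y : ℝ} (hY : 0 < Y) :
    (kernel (u, -Y) : ℂ) = -(Real.pi / 2 * Complex.I) *
      𝓕 (fun σ => (dampedLinear (2 * Real.pi * Y) σ : ℂ)) u := by
  have hplus : (Y + u * Complex.I : ℂ) ≠ 0 := fun h => hY.ne' (by simpa using congrArg Complex.re h)
  have hminus : (Y - u * Complex.I : ℂ) ≠ 0 :=
    fun h => hY.ne' (by simpa using congrArg Complex.re h)
  have hsq : (u ^ 2 + Y ^ 2 : ℂ) = (Y + u * Complex.I) * (Y - u * Complex.I) := by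
    linear_combination ((u : ℂ) ^ 2) * Complex.I_sq
  have hπ : (Real.pi : ℂ) ≠ 0 := Complex.ofReal_ne_zero.2 Real.pi_ne_zero
  rw [fourier_dampedLinear (by positivity), kernel]
  push_cast
  rw [neg_sq, hsq, show (2 * Real.pi * Y + 2 * Real.pi * u * Complex.I : ℂ) =
    2 * Real.pi * (Y + u * Complex.I) by ring, show (2 * Real.pi * Y - 2 * Real.pi * u * Complex.I
    : ℂ) = 2 * Real.pi * (Y - u * Complex.I) by ring]
  field_simp
  linear_combination (-4 * (u : ℂ) * Y) * Complex.I_sq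

end DampedLinear

/-! ### The transform of a tensor product below its support -/

section TensorSymbol

/-- The Laplace transform `∫ e^{-st} ψ(t) dt`, for functions `ψ` supported on `[0, ∞)`. -/
def laplaceTransform (ψ : ℝ → ℝ) (s : ℝ) : ℝ := ∫ t, Real.exp (-(s * t)) * ψ t

variable {ψ : ℝ → ℝ} {s : ℝ}

lemma abs_exp_mul_le_abs (hψ₀ : ∀ t < 0, ψ t = 0) (hs : 0 ≤ s) (t : ℝ) :
    |Real.exp (-(s * t)) * ψ t| ≤ |ψ t| := by
  rcases lt_or_ge t 0 with ht | ht
  · simp [hψ₀ t ht]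
  · rw [abs_mul, Real.abs_exp]
    exact mul_le_of_le_one_left (abs_nonneg _) (Real.exp_le_one_iff.2 (by nlinarith))

lemma integrable_exp_mul (hψ : Integrable ψ) (hψ₀ : ∀ t < 0, ψ t = 0) (hs : 0 ≤ s) :
    Integrable fun t => Real.exp (-(s * t)) * ψ t :=
  hψ.abs.mono' ((by fun_prop : Continuous _).aestronglyMeasurable.mul hψ.1)
    (.of_forall (abs_exp_mul_le_abs hψ₀ hs))

lemma abs_laplaceTransform_le (hψ : Integrable ψ) (hψ₀ : ∀ t < 0, ψ t = 0) (hs : 0 ≤ s) :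
    |laplaceTransform ψ s| ≤ ∫ t, |ψ t| := by
  rw [laplaceTransform, ← Real.norm_eq_abs]
  exact norm_integral_le_of_norm_le hψ.abs (.of_forall (abs_exp_mul_le_abs hψ₀ hs))

lemma aestronglyMeasurable_laplaceTransform (hψ : Integrable ψ) {u : ℝ → ℝ} (hu : Measurable u) :
    AEStronglyMeasurable fun σ => laplaceTransform ψ (u σ) :=
  AEStronglyMeasurable.integral_prod_right' (f := fun z => Real.exp (-(u z.1 * z.2)) * ψ z.2) <|
    (by fun_prop : Measurable fun z : ℝ × ℝ => Real.exp (-(u z.1 * z.2))).aestronglyMeasurable.mul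
      hψ.1.comp_snd

lemma laplaceTransform_nonneg (hψ : ∀ t, 0 ≤ ψ t) (s : ℝ) : 0 ≤ laplaceTransform ψ s :=
  integral_nonneg fun t => mul_nonneg (Real.exp_nonneg _) (hψ t)

lemma exp_neg_mul_integral_le_laplaceTransform (hψ : Integrable ψ) (hψ_nonneg : ∀ t, 0 ≤ ψ t)
    (hψ₀ : ∀ t < 0, ψ t = 0) (hs : 0 ≤ s) {b : ℝ} (hb : ∀ t, ψ t ≠ 0 → s * t ≤ b) :
    Real.exp (-b) * ∫ t, ψ t ≤ laplaceTransform ψ s := by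
  rw [← integral_const_mul]
  refine integral_mono (hψ.const_mul _) (integrable_exp_mul hψ hψ₀ hs) fun t => ?_
  by_cases ht : ψ t = 0
  · simp [ht]
  · exact mul_le_mul_of_nonneg_right (Real.exp_le_exp.2 (neg_le_neg (hb t ht))) (hψ_nonneg t)

/-- The function whose Fourier transform is, up to a constant, the restriction to the horizontal
line at height `y < 0` of the convolution of the kernel with `(u, t) ↦ ψ(t) a(u)`. -/
def tensorSymbol (ψ : ℝ → ℝ) (a : ℝ → ℂ) (y σ : ℝ) : ℂ :=
  dampedLinear (-(2 * Real.pi * y)) σ * (laplaceTransform ψ (2 * Real.pi * |σ|) * 𝓕⁻ a σ)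

variable {a : ℝ → ℂ} {y : ℝ}

lemma aestronglyMeasurable_tensorSymbol (hψ : Integrable ψ) (ha : Integrable a) :
    AEStronglyMeasurable (tensorSymbol ψ a y) := by
  have hlaplace := aestronglyMeasurable_laplaceTransform hψ
    (by fun_prop : Measurable fun σ : ℝ => 2 * Real.pi * |σ|)
  have hfourier : Continuous (𝓕⁻ a) := by
    simp only [funext (Real.fourierInv_eq_fourier_neg a)]
    exact (continuous_fourier ha).comp continuous_neg
  exact (by fun_prop : Continuous fun σ : ℝ =>
    (dampedLinear (-(2 * Real.pi * y)) σ : ℂ)).aestronglyMeasurable.mul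
      ((Complex.continuous_ofReal.comp_aestronglyMeasurable hlaplace).mul
        hfourier.aestronglyMeasurable)

lemma norm_tensorSymbol_le (hψ : Integrable ψ) (hψ₀ : ∀ t < 0, ψ t = 0) (σ : ℝ) :
    ‖tensorSymbol ψ a y σ‖ ≤
      ((∫ t, |ψ t|) * ∫ u, ‖a u‖) * |dampedLinear (-(2 * Real.pi * y)) σ| := by
  rw [tensorSymbol, norm_mul, norm_mul, Complex.norm_real, Complex.norm_real, mul_comm]
  refine mul_le_mul_of_nonneg_right (mul_le_mul ?_ ?_ (norm_nonneg _) (by positivity))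
    (abs_nonneg _)
  · exact abs_laplaceTransform_le hψ hψ₀ (by positivity)
  · rw [Real.fourierInv_eq_fourier_neg]
    exact norm_fourier_le a (-σ)

lemma neg_two_pi_mul_pos (hy : y < 0) : 0 < -(2 * Real.pi * y) :=
  neg_pos.2 (mul_neg_of_pos_of_neg Real.two_pi_pos hy)

lemma integrable_tensorSymbol (hψ : Integrable ψ) (hψ₀ : ∀ t < 0, ψ t = 0) (ha : Integrable a)
    (hy : y < 0) : Integrable (tensorSymbol ψ a y) :=
  ((integrable_dampedLinear (neg_two_pi_mul_pos hy)).abs.const_mul _).mono'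
    (aestronglyMeasurable_tensorSymbol hψ ha) (.of_forall (norm_tensorSymbol_le hψ hψ₀))

lemma memLp_two_tensorSymbol (hψ : Integrable ψ) (hψ₀ : ∀ t < 0, ψ t = 0) (ha : Integrable a)
    (hy : y < 0) : MemLp (tensorSymbol ψ a y) 2 :=
  ((memLp_two_dampedLinear (neg_two_pi_mul_pos hy)).abs.const_mul _).mono'
    (aestronglyMeasurable_tensorSymbol hψ ha) (.of_forall (norm_tensorSymbol_le hψ hψ₀))

/-- The factor `e^{2πiuσ} e^{-2πt|σ|}` of the integral representation of the kernel that depends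
on the point `(u, t)` of the support. -/
def poissonWave (q : ℝ × ℝ) (σ : ℝ) : ℂ :=
  Complex.exp (↑(2 * Real.pi * q.1 * σ) * Complex.I) * Real.exp (-(2 * Real.pi * |σ| * q.2))

lemma norm_poissonWave_le_one {q : ℝ × ℝ} (hq : 0 ≤ q.2) (σ : ℝ) : ‖poissonWave q σ‖ ≤ 1 := by
  rw [poissonWave, norm_mul, Complex.norm_exp_ofReal_mul_I, one_mul, Complex.norm_real,
    Real.norm_eq_abs, Real.abs_exp]
  exact Real.exp_le_one_iff.2 (neg_nonpos.2 (by positivity))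

lemma integral_poissonWave_mul_tensor (ψ : ℝ → ℝ) (a : ℝ → ℂ) (σ : ℝ) :
    ∫ q, poissonWave q σ * (ψ q.2 * a q.1) =
      laplaceTransform ψ (2 * Real.pi * |σ|) * 𝓕⁻ a σ := by
  rw [laplaceTransform, ← integral_complex_ofReal, Real.fourierInv_eq', mul_comm,
    ← integral_prod_mul]
  refine integral_congr_ae (.of_forall fun q => ?_)
  simp only [poissonWave, smul_eq_mul, RCLike.inner_apply, conj_trivial]
  push_cast
  ring_nf

lemma kernel_sub_eq_integral_poissonWave (x : ℝ) {q : ℝ × ℝ} (hq : y < q.2) :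
    (kernel ((x, y) - q) : ℂ) = -(Real.pi / 2 * Complex.I) *
      ∫ σ, poissonWave q σ * (Complex.exp (↑(-2 * Real.pi * σ * x) * Complex.I) *
        dampedLinear (-(2 * Real.pi * y)) σ) := by
  have hpoint : (x, y) - q = (x - q.1, -(q.2 - y)) := by ext <;> simp
  rw [hpoint, kernel_eq_fourier_dampedLinear _ (sub_pos.2 hq),
    Real.fourier_real_eq_integral_exp_smul]
  congr 1
  refine integral_congr_ae (.of_forall fun σ => ?_)
  simp only [poissonWave, dampedLinear, smul_eq_mul]
  push_cast
  rw [mul_left_comm, ← Complex.exp_add, mul_left_comm (Complex.exp _) (σ : ℂ), ← Complex.exp_add,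
    mul_left_comm, ← Complex.exp_add, ← Complex.exp_add]
  ring_nf

lemma integrable_tensor (hψ : Integrable ψ) (ha : Integrable a) :
    Integrable fun q : ℝ × ℝ => (ψ q.2 : ℂ) * a q.1 :=
  (ha.mul_prod hψ.ofReal).congr (.of_forall fun _ => mul_comm _ _)

lemma integral_kernel_mul_tensor (hψ : Integrable ψ) (hψ₀ : ∀ t < 0, ψ t = 0)
    (ha : Integrable a) (x : ℝ) (hy : y < 0) :
    ∫ q, (kernel ((x, y) - q) : ℂ) * (ψ q.2 * a q.1) =
      -(Real.pi / 2 * Complex.I) * 𝓕 (tensorSymbol ψ a y) x := by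
  have htensor := integrable_tensor hψ ha
  have hwave : Integrable fun σ : ℝ => Complex.exp (↑(-2 * Real.pi * σ * x) * Complex.I) *
      dampedLinear (-(2 * Real.pi * y)) σ := by
    refine (integrable_dampedLinear (neg_two_pi_mul_pos hy)).abs.mono'
      (by fun_prop : Continuous _).aestronglyMeasurable (.of_forall fun σ => ?_)
    rw [norm_mul, Complex.norm_exp_ofReal_mul_I, one_mul, Complex.norm_real, Real.norm_eq_abs]
  have hpoisson : Measurable (Function.uncurry poissonWave) := by
    unfold poissonWave Function.uncurry; fun_prop
  have hnonneg : ∀ q : ℝ × ℝ, (ψ q.2 : ℂ) * a q.1 ≠ 0 → 0 ≤ q.2 := fun q hq =>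
    not_lt.1 fun hlt => hq (by simp [hψ₀ _ hlt])
  calc ∫ q, (kernel ((x, y) - q) : ℂ) * (ψ q.2 * a q.1)
      = -(Real.pi / 2 * Complex.I) * ∫ q : ℝ × ℝ, (ψ q.2 * a q.1) * ∫ σ, poissonWave q σ *
          (Complex.exp (↑(-2 * Real.pi * σ * x) * Complex.I) *
            dampedLinear (-(2 * Real.pi * y)) σ) := by
        rw [← integral_const_mul]
        refine integral_congr_ae (.of_forall fun q => ?_)
        by_cases hq : (ψ q.2 : ℂ) * a q.1 = 0
        · simp [hq]
        · simp only [kernel_sub_eq_integral_poissonWave x (hy.trans_le (hnonneg q hq))]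
          ring
    _ = _ := by
        rw [integral_mul_integral_comm htensor hwave hpoisson
          fun q σ hq => norm_poissonWave_le_one (hnonneg q hq) σ,
          Real.fourier_real_eq_integral_exp_smul]
        simp only [integral_poissonWave_mul_tensor, tensorSymbol, smul_eq_mul, mul_assoc]

lemma integrable_kernel_mul_tensor (hψ : Integrable ψ) (hψ₀ : ∀ t < 0, ψ t = 0)
    (ha : Integrable a) (x : ℝ) (hy : y < 0) :
    Integrable fun q => (kernel ((x, y) - q) : ℂ) * (ψ q.2 * a q.1) := by
  have htensor := integrable_tensor hψ ha
  refine (htensor.norm.const_mul (y ^ 2)⁻¹).mono'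
    ((by fun_prop : Measurable _).aestronglyMeasurable.mul htensor.1) (.of_forall fun q => ?_)
  rw [norm_mul]
  rcases lt_or_ge q.2 0 with hq | hq
  · simp [hψ₀ _ hq]
  · rw [Complex.norm_real]
    refine mul_le_mul_of_nonneg_right ((abs_kernel_le _).trans ?_) (norm_nonneg _)
    have hsq : 0 < y ^ 2 := sq_pos_of_neg hy
    simp only [Prod.fst_sub, Prod.snd_sub]
    exact inv_anti₀ hsq (by nlinarith [sq_nonneg (x - q.1)])

lemma fourier_finsetSum {ι : Type*} {S : Finset ι} {f : ι → ℝ → ℂ}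
    (hf : ∀ i ∈ S, Integrable (f i)) (w : ℝ) :
    𝓕 (fun v => ∑ i ∈ S, f i v) w = ∑ i ∈ S, 𝓕 (f i) w := by
  simp only [Real.fourier_eq, Finset.smul_sum]
  exact integral_finsetSum S fun i hi => (Real.fourierIntegral_convergent_iff w).2 (hf i hi)

theorem eLpNorm_R₁₂_sum_tensor {ι : Type*} {S : Finset ι} {ψ : ι → ℝ → ℝ} {a : ι → ℝ → ℂ}
    (hψ : ∀ i ∈ S, Integrable (ψ i)) (hψ₀ : ∀ i ∈ S, ∀ t < 0, ψ i t = 0)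
    (ha : ∀ i ∈ S, Integrable (a i)) (hy : y < 0) :
    eLpNorm (fun x => R₁₂ (fun q => ∑ i ∈ S, ψ i q.2 * a i q.1) (x, y)) 2 =
      ‖(Real.pi / 2 : ℝ)‖ₑ * eLpNorm (fun σ => ∑ i ∈ S, tensorSymbol (ψ i) (a i) y σ) 2 := by
  have hsymbol : ∀ i ∈ S, Integrable (tensorSymbol (ψ i) (a i) y) := fun i hi =>
    integrable_tensorSymbol (hψ i hi) (hψ₀ i hi) (ha i hi) hy
  have htransform : (fun x => R₁₂ (fun q => ∑ i ∈ S, (ψ i q.2 : ℂ) * a i q.1) (x, y)) =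
      -(Real.pi / 2 * Complex.I) • 𝓕 (fun σ => ∑ i ∈ S, tensorSymbol (ψ i) (a i) y σ) := by
    ext x
    have hkernel := fun i hi => integrable_kernel_mul_tensor (hψ i hi) (hψ₀ i hi) (ha i hi) x hy
    rw [R₁₂_eq_integral (by simpa only [Finset.mul_sum] using integrable_finsetSum S hkernel)]
    simp only [Finset.mul_sum, Pi.smul_apply]
    rw [integral_finsetSum S hkernel, fourier_finsetSum hsymbol, Finset.smul_sum]
    exact Finset.sum_congr rfl fun i hi =>
      integral_kernel_mul_tensor (hψ i hi) (hψ₀ i hi) (ha i hi) x hy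
  rw [htransform, eLpNorm_const_smul, eLpNorm_two_fourier (integrable_finsetSum S hsymbol)
    (memLp_finsetSum S fun i hi =>
      memLp_two_tensorSymbol (hψ i hi) (hψ₀ i hi) (ha i hi) hy)]
  congr 1
  rw [enorm_eq_iff_norm_eq, norm_neg, norm_mul, Complex.norm_I, mul_one]
  simp

end TensorSymbol

/-! ### Bumps and their Fourier profiles -/

section Bump

lemma exists_isBump {a b c d : ℝ} (hac : a < c) (hdb : d < b) : ∃ φ, IsBump φ a b c d := by
  have hdisj : Disjoint (Set.Ioo a b)ᶜ (Set.Icc c d) :=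
    Set.disjoint_compl_left_iff_subset.2 fun t ht => ⟨hac.trans_le ht.1, ht.2.trans_lt hdb⟩
  obtain ⟨φ, hzero, hone, hmem⟩ := exists_contMDiffMap_zero_one_of_isClosed (n := (⊤ : ℕ∞))
    (modelWithCornersSelf ℝ ℝ) isOpen_Ioo.isClosed_compl isClosed_Icc hdisj
  refine ⟨φ, φ.contMDiff.contDiff, hmem, fun t ht => ?_, fun t ht => hone ht⟩
  exact Set.Ioo_subset_Icc_self (not_not.1 fun hmem => ht (hzero hmem))

namespace IsBump

variable {φ : ℝ → ℝ} {a b c d : ℝ}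

lemma nonneg (hφ : IsBump φ a b c d) (t : ℝ) : 0 ≤ φ t := (hφ.2.1 t).1

lemma le_one (hφ : IsBump φ a b c d) (t : ℝ) : φ t ≤ 1 := (hφ.2.1 t).2

lemma support_subset_Ioo (hφ : IsBump φ a b c d) : Function.support φ ⊆ Set.Ioo a b :=
  (interior_maximal hφ.2.2.1 hφ.1.continuous.isOpen_support).trans interior_Icc.subset

lemma hasCompactSupport (hφ : IsBump φ a b c d) : HasCompactSupport φ :=
  HasCompactSupport.of_support_subset_isCompact isCompact_Icc hφ.2.2.1

lemma integrable (hφ : IsBump φ a b c d) : Integrable φ :=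
  hφ.1.continuous.integrable_of_hasCompactSupport hφ.hasCompactSupport

lemma sub_le_integral (hφ : IsBump φ a b c d) : d - c ≤ ∫ t, φ t :=
  calc d - c ≤ volume.real (Set.Icc c d) := by
        rw [Real.volume_real_Icc]; exact le_max_left _ _
    _ = ∫ t in Set.Icc c d, φ t := by
        rw [setIntegral_congr_fun measurableSet_Icc hφ.2.2.2, setIntegral_const, smul_eq_mul,
          mul_one]
    _ ≤ ∫ t, φ t := setIntegral_le_integral hφ.integrable (.of_forall hφ.nonneg)

end IsBump

/-- A smooth bump on the dyadic shell `[2^{-j}, 2^{-j+1}]`, equal to `1` except near its ends. -/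
def IsShellBump (ψ : ℝ → ℝ) (j : ℕ) : Prop :=
  IsBump ψ ((2 : ℝ) ^ (-(j : ℤ))) ((2 : ℝ) ^ (-(j : ℤ) + 1))
    ((2 : ℝ) ^ (-(j : ℤ)) + (2 : ℝ) ^ (-(j : ℤ) - 10))
    ((2 : ℝ) ^ (-(j : ℤ) + 1) - (2 : ℝ) ^ (-(j : ℤ) - 10))

lemma exists_isShellBump (j : ℕ) : ∃ ψ, IsShellBump ψ j :=
  have hpos : (0 : ℝ) < 2 ^ (-(j : ℤ) - 10) := by positivity
  exists_isBump (lt_add_of_pos_right _ hpos) (sub_lt_self _ hpos)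

namespace IsShellBump

variable {ψ : ℝ → ℝ} {j : ℕ}

lemma isBump (hψ : IsShellBump ψ j) : IsBump ψ ((2 : ℝ) ^ (-(j : ℤ))) ((2 : ℝ) ^ (-(j : ℤ) + 1))
    ((2 : ℝ) ^ (-(j : ℤ)) + (2 : ℝ) ^ (-(j : ℤ) - 10))
    ((2 : ℝ) ^ (-(j : ℤ) + 1) - (2 : ℝ) ^ (-(j : ℤ) - 10)) := hψ

lemma one_lt_two_pow_mul (hψ : IsShellBump ψ j) {t : ℝ} (ht : ψ t ≠ 0) : 1 < 2 ^ j * t := by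
  have hlt := (hψ.isBump.support_subset_Ioo ht).1
  rwa [zpow_neg, zpow_natCast, inv_lt_iff_one_lt_mul₀' (by positivity)] at hlt

lemma two_pow_mul_lt_two (hψ : IsShellBump ψ j) {t : ℝ} (ht : ψ t ≠ 0) : 2 ^ j * t < 2 := by
  have hlt := (hψ.isBump.support_subset_Ioo ht).2
  rwa [zpow_add₀ two_ne_zero, zpow_neg, zpow_natCast, zpow_one, ← div_eq_inv_mul,
    lt_div_iff₀' (by positivity)] at hlt

lemma pos (hψ : IsShellBump ψ j) {t : ℝ} (ht : ψ t ≠ 0) : 0 < t :=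
  pos_of_mul_pos_right (one_pos.trans (hψ.one_lt_two_pow_mul ht)) (by positivity)

lemma eq_zero_of_neg (hψ : IsShellBump ψ j) (t : ℝ) (ht : t < 0) : ψ t = 0 :=
  not_not.1 fun hne => ht.not_gt (hψ.pos hne)

lemma half_le_two_pow_mul_integral (hψ : IsShellBump ψ j) : 1 / 2 ≤ 2 ^ j * ∫ t, ψ t := by
  have hle := hψ.isBump.sub_le_integral
  rw [zpow_add₀ two_ne_zero, zpow_sub₀ two_ne_zero, zpow_neg, zpow_natCast, zpow_one] at hle
  have hmul : (2 : ℝ) ^ j * (2 ^ j)⁻¹ = 1 := mul_inv_cancel₀ (by positivity)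
  norm_num at hle
  nlinarith [mul_le_mul_of_nonneg_left hle (show (0 : ℝ) ≤ 2 ^ j by positivity)]

lemma eq_of_ne_zero {ψ' : ℝ → ℝ} {k : ℕ} (hψ : IsShellBump ψ j) (hψ' : IsShellBump ψ' k) {t : ℝ}
    (ht : ψ t ≠ 0) (ht' : ψ' t ≠ 0) : j = k := by
  have hle : ∀ {φ φ' : ℝ → ℝ} {m l : ℕ}, IsShellBump φ m → IsShellBump φ' l → φ t ≠ 0 →
      φ' t ≠ 0 → l ≤ m := fun {φ φ' m l} hφ hφ' h h' => by
    by_contra! hlt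
    have hpow : (2 : ℝ) ^ (m + 1) ≤ 2 ^ l := pow_le_pow_right₀ one_le_two hlt
    have := hφ.one_lt_two_pow_mul h
    have := hφ'.two_pow_mul_lt_two h'
    rw [pow_succ] at hpow
    nlinarith [hφ.pos h]
  exact le_antisymm (hle hψ' hψ ht' ht) (hle hψ hψ' ht ht')

end IsShellBump

lemma sum_shellBump_le {ψ : ℕ → ℝ → ℝ} (hψ : ∀ j, IsShellBump (ψ j) j) (S : Finset ℕ) (y : ℝ) :
    ∑ j ∈ S, ψ j y ≤ Real.exp 4 * Real.exp (-y ^ 2) := by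
  by_cases hzero : ∀ j ∈ S, ψ j y = 0
  · rw [Finset.sum_eq_zero hzero]
    positivity
  · push Not at hzero
    obtain ⟨j, hj, hne⟩ := hzero
    have hy := (hψ j).two_pow_mul_lt_two hne
    have hpos := (hψ j).pos hne
    have htwo : y < 2 := by nlinarith [one_le_pow₀ (M₀ := ℝ) (n := j) one_le_two]
    rw [Finset.sum_eq_single_of_mem j hj fun k _ hkj =>
      not_not.1 fun hk => hkj ((hψ k).eq_of_ne_zero (hψ j) hk hne), ← Real.exp_add]
    exact ((hψ j).isBump.le_one y).trans (Real.one_le_exp (by nlinarith))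

end Bump

section Profile

lemma norm_invFourier_le (φ : ℝ → ℝ) (x : ℝ) : ‖invFourier φ x‖ ≤ ∫ ξ, |φ ξ| := by
  have hsqrt : 1 ≤ √(2 * Real.pi) := Real.one_le_sqrt.2 (by linarith [Real.pi_gt_three])
  have hint : ‖∫ ξ : ℝ, Complex.exp (Complex.I * x * ξ) * (φ ξ : ℂ)‖ ≤ ∫ ξ, |φ ξ| := by
    refine (norm_integral_le_integral_norm _).trans_eq (integral_congr_ae (.of_forall fun ξ => ?_))
    simp only [norm_mul, Complex.norm_real, Real.norm_eq_abs, mul_assoc, Complex.norm_exp,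
      Complex.I_mul_re]
    simp
  rw [invFourier, norm_mul, Complex.norm_real, Real.norm_of_nonneg (by positivity)]
  exact (mul_le_of_le_one_left (norm_nonneg _) (inv_le_one_of_one_le₀ hsqrt)).trans hint

lemma integrable_gaussian_wave (σ : ℝ) : Integrable fun x : ℝ =>
    Complex.exp (↑(2 * Real.pi * (x * σ)) * Complex.I) * (Real.exp (-x ^ 2) : ℂ) := by
  refine (integrable_exp_neg_mul_sq one_pos).mono'
    (by fun_prop : Continuous _).aestronglyMeasurable (.of_forall fun x => ?_)
  rw [norm_mul, Complex.norm_exp_ofReal_mul_I, one_mul, Complex.norm_real, Real.norm_eq_abs,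
    Real.abs_exp, neg_mul, one_mul]

lemma integral_gaussian_wave (σ ξ : ℝ) :
    ∫ x : ℝ, Complex.exp (Complex.I * x * ξ) *
        (Complex.exp (↑(2 * Real.pi * (x * σ)) * Complex.I) * (Real.exp (-x ^ 2) : ℂ)) =
      (√Real.pi * Real.exp (-(ξ + 2 * Real.pi * σ) ^ 2 / 4) : ℝ) := by
  have hgauss := fourierIntegral_gaussian (b := 1) (by simp) (ξ + 2 * Real.pi * σ : ℝ)
  simp only [div_one, mul_one] at hgauss
  calc _ = ∫ x : ℝ, Complex.exp (Complex.I * (ξ + 2 * Real.pi * σ : ℝ) * x) *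
        Complex.exp (-1 * x ^ 2) := by
        refine integral_congr_ae (.of_forall fun x => ?_)
        simp only [← mul_assoc, ← Complex.exp_add]
        push_cast
        rw [← Complex.exp_add]
        ring_nf
    _ = _ := by
        rw [hgauss, Real.sqrt_eq_rpow, Complex.ofReal_mul, Complex.ofReal_cpow Real.pi_pos.le]
        push_cast
        rfl

lemma fourierInv_gaussian_mul_invFourier {φ : ℝ → ℝ} (hφ : Integrable φ) (σ : ℝ) :
    𝓕⁻ (fun x : ℝ => (Real.exp (-x ^ 2) : ℂ) * invFourier φ x) σ =
      ((√2)⁻¹ * ∫ ξ, Real.exp (-(ξ + 2 * Real.pi * σ) ^ 2 / 4) * φ ξ : ℝ) := by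
  have hφ' : Integrable fun ξ => (φ ξ : ℂ) := hφ.ofReal
  have hwave : Measurable (Function.uncurry fun x ξ : ℝ => Complex.exp (Complex.I * x * ξ)) := by
    unfold Function.uncurry; fun_prop
  have hnorm : ∀ x ξ : ℝ, ‖Complex.exp (Complex.I * x * ξ)‖ ≤ 1 := fun x ξ => by
    rw [mul_assoc, ← Complex.ofReal_mul, Complex.norm_exp_I_mul_ofReal]
  have hsqrt : (√(2 * Real.pi))⁻¹ * √Real.pi = (√2)⁻¹ := by
    rw [Real.sqrt_mul zero_le_two]
    field_simp
  calc 𝓕⁻ (fun x : ℝ => (Real.exp (-x ^ 2) : ℂ) * invFourier φ x) σ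
      = ((√(2 * Real.pi))⁻¹ : ℝ) * ∫ x : ℝ,
          (Complex.exp (↑(2 * Real.pi * (x * σ)) * Complex.I) * (Real.exp (-x ^ 2) : ℂ)) *
            ∫ ξ : ℝ, Complex.exp (Complex.I * x * ξ) * φ ξ := by
        rw [Real.fourierInv_eq', ← integral_const_mul]
        refine integral_congr_ae (.of_forall fun x => ?_)
        simp only [invFourier, smul_eq_mul, RCLike.inner_apply, conj_trivial, mul_comm σ x]
        ring
    _ = ((√(2 * Real.pi))⁻¹ : ℝ) * ∫ ξ : ℝ, (φ ξ : ℂ) *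
          (√Real.pi * Real.exp (-(ξ + 2 * Real.pi * σ) ^ 2 / 4) : ℝ) := by
        rw [integral_mul_integral_comm (integrable_gaussian_wave σ) hφ' hwave
          fun x ξ _ => hnorm x ξ]
        simp only [integral_gaussian_wave]
    _ = _ := by
        rw [← hsqrt, mul_assoc (√_)⁻¹, Complex.ofReal_mul, ← integral_const_mul (√Real.pi),
          ← integral_complex_ofReal]
        congr 1
        refine integral_congr_ae (.of_forall fun ξ => ?_)
        push_cast
        ring

/-- The factor `e^{-x²} 𝓕⁻¹(χ₃^{(j)})(x)` of the tensor bumps. -/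
def profile (χ : ℝ → ℝ) (j : ℕ) (x : ℝ) : ℂ :=
  (Real.exp (-x ^ 2) : ℂ) * invFourier (freqCutoff χ j) x

lemma tensorBump_eq_mul_profile (χ ψ : ℝ → ℝ) (j : ℕ) (p : ℝ × ℝ) :
    tensorBump χ ψ j p = ψ p.2 * profile χ j p.1 :=
  mul_assoc _ _ _

variable {χ : ℝ → ℝ}

lemma integrable_freqCutoff (hχ : Integrable χ) (j : ℕ) : Integrable (freqCutoff χ j) :=
  (hχ.comp_sub_right _).add ((hχ.comp_sub_right _).comp_neg)

lemma integral_comp_neg_sub (χ : ℝ → ℝ) (a : ℝ) : ∫ ξ, χ (-ξ - a) = ∫ ξ, χ ξ := by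
  rw [integral_neg_eq_self fun ξ => χ (ξ - a), integral_sub_right_eq_self χ]

lemma integral_freqCutoff (hχ : Integrable χ) (j : ℕ) :
    ∫ ξ, freqCutoff χ j ξ = 2 * ∫ ξ, χ ξ := by
  simp only [freqCutoff]
  rw [integral_add (hχ.comp_sub_right _) (hχ.comp_sub_right _).comp_neg,
    integral_sub_right_eq_self χ, integral_comp_neg_sub, two_mul]

lemma freqCutoff_nonneg (hχ : ∀ ξ, 0 ≤ χ ξ) (j : ℕ) (ξ : ℝ) : 0 ≤ freqCutoff χ j ξ :=
  add_nonneg (hχ _) (hχ _)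

lemma norm_profile_le (hχ : Integrable χ) (hχ_nonneg : ∀ ξ, 0 ≤ χ ξ) (j : ℕ) (x : ℝ) :
    ‖profile χ j x‖ ≤ 2 * (∫ ξ, χ ξ) * Real.exp (-x ^ 2) := by
  have hle := norm_invFourier_le (freqCutoff χ j) x
  simp only [abs_of_nonneg (freqCutoff_nonneg hχ_nonneg j _), integral_freqCutoff hχ] at hle
  rw [profile, norm_mul, Complex.norm_real, Real.norm_of_nonneg (Real.exp_nonneg _), mul_comm]
  gcongr

lemma aestronglyMeasurable_invFourier {φ : ℝ → ℝ} (hφ : Integrable φ) :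
    AEStronglyMeasurable (invFourier φ) := by
  have hφ' : Integrable fun ξ => (φ ξ : ℂ) := hφ.ofReal
  exact (AEStronglyMeasurable.integral_prod_right'
    (f := fun z : ℝ × ℝ => Complex.exp (Complex.I * z.1 * z.2) * φ z.2) <|
      (by fun_prop : Continuous fun z : ℝ × ℝ =>
        Complex.exp (Complex.I * z.1 * z.2)).aestronglyMeasurable.mul hφ'.1.comp_snd).const_mul _

lemma integrable_profile (hχ : Integrable χ) (hχ_nonneg : ∀ ξ, 0 ≤ χ ξ) (j : ℕ) :
    Integrable (profile χ j) := by
  have hgauss : Integrable fun x : ℝ => Real.exp (-x ^ 2) := by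
    simpa using integrable_exp_neg_mul_sq one_pos
  exact (hgauss.const_mul _).mono' ((by fun_prop : Continuous _).aestronglyMeasurable.mul
    (aestronglyMeasurable_invFourier (integrable_freqCutoff hχ j)))
      (.of_forall (norm_profile_le hχ hχ_nonneg j))

/-- The inverse Fourier transform of `profile χ j`: a Gaussian average of the frequency cutoff. -/
def profileSymbol (χ : ℝ → ℝ) (j : ℕ) (σ : ℝ) : ℝ :=
  (√2)⁻¹ * ∫ ξ, Real.exp (-(ξ + 2 * Real.pi * σ) ^ 2 / 4) * freqCutoff χ j ξ

lemma fourierInv_profile (hχ : Integrable χ) (j : ℕ) (σ : ℝ) :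
    𝓕⁻ (profile χ j) σ = profileSymbol χ j σ :=
  fourierInv_gaussian_mul_invFourier (integrable_freqCutoff hχ j) σ

lemma profileSymbol_nonneg (hχ : ∀ ξ, 0 ≤ χ ξ) (j : ℕ) (σ : ℝ) : 0 ≤ profileSymbol χ j σ :=
  mul_nonneg (by positivity)
    (integral_nonneg fun ξ => mul_nonneg (Real.exp_nonneg _) (freqCutoff_nonneg hχ j ξ))

lemma le_profileSymbol {A : ℝ} (hχ : Integrable χ) (hχ_nonneg : ∀ ξ, 0 ≤ χ ξ)
    (hχ_supp : Function.support χ ⊆ Set.Icc 0 A) {j : ℕ} {σ : ℝ}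
    (hσ : 2 * Real.pi * σ ∈ Set.Icc (2 ^ j) (2 ^ j + 1)) :
    (√2)⁻¹ * (Real.exp (-(A + 1) ^ 2 / 4) * ∫ ξ, χ ξ) ≤ profileSymbol χ j σ := by
  have hint : Integrable fun ξ =>
      Real.exp (-(ξ + 2 * Real.pi * σ) ^ 2 / 4) * freqCutoff χ j ξ := by
    refine (integrable_freqCutoff hχ j).bdd_mul (c := 1)
      (by fun_prop : Continuous _).aestronglyMeasurable (.of_forall fun ξ => ?_)
    rw [Real.norm_eq_abs, Real.abs_exp, Real.exp_le_one_iff]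
    linarith [sq_nonneg (ξ + 2 * Real.pi * σ)]
  rw [profileSymbol, ← integral_comp_neg_sub χ (2 ^ j), ← integral_const_mul]
  refine mul_le_mul_of_nonneg_left (integral_mono
    ((hχ.comp_sub_right (2 ^ j)).comp_neg.const_mul _) hint fun ξ => ?_) (by positivity)
  refine le_trans ?_ (mul_le_mul_of_nonneg_left (le_add_of_nonneg_left (hχ_nonneg (ξ - 2 ^ j)))
    (Real.exp_nonneg _))
  by_cases hξ : χ (-ξ - 2 ^ j) = 0
  · simp [hξ]
  · obtain ⟨hlow, hhigh⟩ := hχ_supp hξ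
    refine mul_le_mul_of_nonneg_right (Real.exp_le_exp.2 ?_) (hχ_nonneg _)
    have hsq : (ξ + 2 * Real.pi * σ) ^ 2 ≤ (A + 1) ^ 2 :=
      sq_le_sq' (by linarith [hσ.1]) (by linarith [hσ.2])
    linarith

end Profile

/-! ### The two mixed norms of the sums -/

section LowerBound

lemma mul_rpow_measure_le_eLpNorm {X E : Type*} [MeasurableSpace X] {μ : Measure X}
    [NormedAddCommGroup E] {f : X → E} {p : ℝ≥0∞} (hp₀ : p ≠ 0) (hp : p ≠ ∞) {s : Set X}
    (hs : MeasurableSet s) {c : ℝ} (hc : 0 ≤ c) (hf : ∀ x ∈ s, c ≤ ‖f x‖) :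
    ENNReal.ofReal c * μ s ^ (1 / p.toReal) ≤ eLpNorm f p μ := by
  rw [← Real.enorm_of_nonneg hc, ← eLpNorm_indicator_const hs hp₀ hp]
  refine eLpNorm_mono fun x => ?_
  by_cases hx : x ∈ s
  · rw [Set.indicator_of_mem hx, Real.norm_of_nonneg hc]
    exact hf x hx
  · rw [Set.indicator_of_notMem hx, norm_zero]
    exact norm_nonneg _

lemma le_normXthenY_top {F : ℝ × ℝ → ℂ} {p B : ℝ≥0∞} {s : Set ℝ} (hs : volume s ≠ 0)
    (hB : ∀ y ∈ s, B ≤ eLpNorm (fun x => F (x, y)) p) : B ≤ normXthenY p ∞ F := by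
  by_contra! hlt
  refine hs (measure_mono_null (fun y hy => ?_) (ae_iff.1 (ae_le_eLpNormEssSup
    (f := fun y => eLpNorm (fun x => F (x, y)) p) (μ := volume))))
  rw [normXthenY, eLpNorm_exponent_top] at hlt
  exact not_le.2 (hlt.trans_le (hB y hy))

/-- The frequencies `σ` with `2πσ ∈ [2^j, 2^j + 1)`, where the `j`-th tensor bump dominates. -/
def freqBand (j : ℕ) : Set ℝ :=
  Set.Ico (2 ^ j / (2 * Real.pi)) ((2 ^ j + 1) / (2 * Real.pi))

lemma volume_freqBand (j : ℕ) : volume (freqBand j) = ENNReal.ofReal (1 / (2 * Real.pi)) := by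
  rw [freqBand, Real.volume_Ico, ← sub_div, add_sub_cancel_left]

lemma mem_freqBand {j : ℕ} {σ : ℝ} :
    σ ∈ freqBand j ↔ 2 ^ j ≤ 2 * Real.pi * σ ∧ 2 * Real.pi * σ < 2 ^ j + 1 := by
  rw [freqBand, Set.mem_Ico, div_le_iff₀' Real.two_pi_pos, lt_div_iff₀' Real.two_pi_pos]

lemma pairwise_disjoint_freqBand : Pairwise (Function.onFun Disjoint freqBand) := by
  refine (pairwise_disjoint_on freqBand).2 fun j k hjk => Set.disjoint_left.2 fun σ hj hk => ?_
  have hpow : (2 : ℝ) ^ (j + 1) ≤ 2 ^ k := pow_le_pow_right₀ one_le_two hjk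
  have hone : (1 : ℝ) ≤ 2 ^ j := one_le_pow₀ one_le_two
  rw [pow_succ] at hpow
  linarith [(mem_freqBand.1 hj).2, (mem_freqBand.1 hk).1]

lemma volume_biUnion_freqBand (S : Finset ℕ) :
    volume (⋃ j ∈ S, freqBand j) = S.card * ENNReal.ofReal (1 / (2 * Real.pi)) := by
  rw [measure_biUnion_finset (pairwise_disjoint_freqBand.set_pairwise _)
    fun j _ => measurableSet_Ico]
  simp only [volume_freqBand, Finset.sum_const, nsmul_eq_mul]

variable {χ φ : ℝ → ℝ} {j : ℕ} {y σ : ℝ}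

lemma le_dampedLinear_of_mem_freqBand (hy : y < 0) (hyj : -(y * 2 ^ j) ≤ 1)
    (hσ : σ ∈ freqBand j) :
    2 ^ j / (2 * Real.pi) * Real.exp (-2) ≤ dampedLinear (-(2 * Real.pi * y)) σ := by
  have hone : (1 : ℝ) ≤ 2 ^ j := one_le_pow₀ one_le_two
  have hhigh := (mem_freqBand.1 hσ).2
  have hσ₀ : 0 ≤ σ := le_trans (by positivity) hσ.1
  rw [dampedLinear, abs_of_nonneg hσ₀]
  gcongr
  · exact hσ.1
  · nlinarith

lemma IsShellBump.le_laplaceTransform (hφ : IsShellBump φ j) {s : ℝ} (hs : 0 ≤ s)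
    (hsj : s ≤ 2 ^ j + 1) : Real.exp (-4) * ∫ t, φ t ≤ laplaceTransform φ s := by
  refine exp_neg_mul_integral_le_laplaceTransform hφ.isBump.integrable hφ.isBump.nonneg
    hφ.eq_zero_of_neg hs fun t ht => ?_
  have hone : (1 : ℝ) ≤ 2 ^ j := one_le_pow₀ one_le_two
  nlinarith [hφ.two_pow_mul_lt_two ht, hφ.pos ht]

/-- The value `tensorSymbol φ (profile χ j) y σ`, which is real. -/
def bumpSymbol (χ φ : ℝ → ℝ) (j : ℕ) (y σ : ℝ) : ℝ :=
  dampedLinear (-(2 * Real.pi * y)) σ *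
    (laplaceTransform φ (2 * Real.pi * |σ|) * profileSymbol χ j σ)

lemma tensorSymbol_profile (hχ : Integrable χ) :
    tensorSymbol φ (profile χ j) y σ = bumpSymbol χ φ j y σ := by
  rw [tensorSymbol, fourierInv_profile hχ, bumpSymbol]
  push_cast
  rfl

lemma bumpSymbol_nonneg (hχ : ∀ ξ, 0 ≤ χ ξ) (hφ : ∀ t, 0 ≤ φ t) (hσ : 0 ≤ σ) :
    0 ≤ bumpSymbol χ φ j y σ :=
  mul_nonneg (mul_nonneg hσ (Real.exp_nonneg _))
    (mul_nonneg (laplaceTransform_nonneg hφ _) (profileSymbol_nonneg hχ j σ))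

variable {A c d : ℝ}

lemma IsBump.exists_le_bumpSymbol (hχ : IsBump χ 0 A c d) (hcd : c < d) :
    ∃ m > 0, ∀ {φ j y σ}, IsShellBump φ j → y < 0 → -(y * 2 ^ j) ≤ 1 → σ ∈ freqBand j →
      m ≤ bumpSymbol χ φ j y σ := by
  have hmass : 0 < ∫ ξ, χ ξ := (sub_pos.2 hcd).trans_le hχ.sub_le_integral
  refine ⟨1 / (4 * Real.pi) * Real.exp (-6) *
    ((√2)⁻¹ * (Real.exp (-(A + 1) ^ 2 / 4) * ∫ ξ, χ ξ)), by positivity,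
    fun {φ j y σ} hφ hy hyj hσ => ?_⟩
  obtain ⟨hlow, hhigh⟩ := mem_freqBand.1 hσ
  have hσ₀ : 0 ≤ σ := le_trans (by positivity) hσ.1
  have hdamp := le_dampedLinear_of_mem_freqBand hy hyj hσ
  have hlaplace := hφ.le_laplaceTransform (by positivity) hhigh.le
  have hprofile := le_profileSymbol hχ.integrable hχ.nonneg hχ.2.2.1 ⟨hlow, hhigh.le⟩
  have hφ_nonneg : 0 ≤ ∫ t, φ t := integral_nonneg hφ.isBump.nonneg
  rw [bumpSymbol, abs_of_nonneg hσ₀, ← mul_assoc (dampedLinear _ _)]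
  refine mul_le_mul ?_ hprofile (by positivity)
    (mul_nonneg (le_trans (by positivity) hdamp) (le_trans (by positivity) hlaplace))
  calc 1 / (4 * Real.pi) * Real.exp (-6)
      = 1 / (2 * Real.pi) * Real.exp (-2) * Real.exp (-4) * (1 / 2) := by
        rw [show (-6 : ℝ) = -2 + -4 by norm_num, Real.exp_add]; ring
    _ ≤ 1 / (2 * Real.pi) * Real.exp (-2) * Real.exp (-4) * (2 ^ j * ∫ t, φ t) := by
        gcongr
        exact hφ.half_le_two_pow_mul_integral
    _ = 2 ^ j / (2 * Real.pi) * Real.exp (-2) * (Real.exp (-4) * ∫ t, φ t) := by ring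
    _ ≤ _ := mul_le_mul hdamp hlaplace (by positivity) (le_trans (by positivity) hdamp)

variable {ψ : ℕ → ℝ → ℝ}

lemma IsBump.exists_le_norm_sum_tensorSymbol (hχ : IsBump χ 0 A c d) (hcd : c < d)
    (hψ : ∀ j, IsShellBump (ψ j) j) :
    ∃ m > 0, ∀ (S : Finset ℕ), ∀ y < 0, (∀ j ∈ S, -(y * 2 ^ j) ≤ 1) → ∀ σ ∈ ⋃ j ∈ S, freqBand j,
      m ≤ ‖∑ j ∈ S, tensorSymbol (ψ j) (profile χ j) y σ‖ := by
  obtain ⟨m, hm, hle⟩ := hχ.exists_le_bumpSymbol hcd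
  refine ⟨m, hm, fun S y hy hyS σ hσ => ?_⟩
  obtain ⟨j, hj, hσj⟩ := Set.mem_iUnion₂.1 hσ
  have hσ₀ : 0 ≤ σ := le_trans (by positivity) hσj.1
  simp only [tensorSymbol_profile hχ.integrable, ← Complex.ofReal_sum, Complex.norm_real]
  calc m ≤ bumpSymbol χ (ψ j) j y σ := hle (hψ j) hy (hyS j hj) hσj
    _ ≤ ∑ k ∈ S, bumpSymbol χ (ψ k) k y σ := Finset.single_le_sum
        (f := fun k => bumpSymbol χ (ψ k) k y σ)
        (fun k _ => bumpSymbol_nonneg hχ.nonneg (hψ k).isBump.nonneg hσ₀) hj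
    _ ≤ _ := le_abs_self _

lemma IsBump.exists_mul_rpow_le_eLpNorm_R₁₂ (hχ : IsBump χ 0 A c d) (hcd : c < d)
    (hψ : ∀ j, IsShellBump (ψ j) j) :
    ∃ m > 0, ∀ (S : Finset ℕ), ∀ y < 0, (∀ j ∈ S, -(y * 2 ^ j) ≤ 1) →
      ENNReal.ofReal m * (S.card * ENNReal.ofReal (1 / (2 * Real.pi))) ^ (1 / 2 : ℝ) ≤
        eLpNorm (fun x => R₁₂ (fun q => ∑ j ∈ S, tensorBump χ (ψ j) j q) (x, y)) 2 := by
  obtain ⟨m, hm, hle⟩ := hχ.exists_le_norm_sum_tensorSymbol hcd hψ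
  refine ⟨m, hm, fun S y hy hyS => ?_⟩
  have hbands := mul_rpow_measure_le_eLpNorm (μ := volume)
    (s := ⋃ j ∈ S, freqBand j) two_ne_zero ENNReal.ofNat_ne_top
    (S.measurableSet_biUnion fun j _ => measurableSet_Ico) hm.le (hle S y hy hyS)
  have hπ : 1 ≤ ‖(Real.pi / 2 : ℝ)‖ₑ := by
    rw [Real.enorm_of_nonneg (by positivity), ENNReal.one_le_ofReal]
    linarith [Real.pi_gt_three]
  rw [volume_biUnion_freqBand, ENNReal.toReal_ofNat] at hbands
  simp only [tensorBump_eq_mul_profile]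
  rw [eLpNorm_R₁₂_sum_tensor (fun j _ => (hψ j).isBump.integrable)
    (fun j _ => (hψ j).eq_zero_of_neg)
    (fun j _ => integrable_profile hχ.integrable hχ.nonneg j) hy]
  exact hbands.trans (le_mul_of_one_le_left' hπ)

theorem IsBump.tendsto_normXthenY_R₁₂ (hχ : IsBump χ 0 A c d) (hcd : c < d)
    (hψ : ∀ j, IsShellBump (ψ j) j) (n₀ : ℕ) :
    Tendsto (fun n => normXthenY 2 ∞ (R₁₂ fun q => ∑ j ∈ Finset.Icc n₀ n, tensorBump χ (ψ j) j q))
      atTop (𝓝 ∞) := by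
  obtain ⟨m, hm, hle⟩ := hχ.exists_mul_rpow_le_eLpNorm_R₁₂ hcd hψ
  have hcard : Tendsto (fun n => ((Finset.Icc n₀ n).card : ℝ≥0∞)) atTop (𝓝 ∞) := by
    refine ENNReal.tendsto_nat_nhds_top.comp ?_
    simp only [Nat.card_Icc]
    exact tendsto_sub_atTop_nat n₀ |>.comp (tendsto_add_atTop_nat 1)
  have hlower : Tendsto (fun n => ENNReal.ofReal m * ((Finset.Icc n₀ n).card *
      ENNReal.ofReal (1 / (2 * Real.pi))) ^ (1 / 2 : ℝ)) atTop (𝓝 ∞) := by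
    have hband : ENNReal.ofReal (1 / (2 * Real.pi)) ≠ 0 :=
      (ENNReal.ofReal_pos.2 (by positivity)).ne'
    have hmeasure := ENNReal.Tendsto.mul_const (b := ENNReal.ofReal (1 / (2 * Real.pi))) hcard
      (.inl ENNReal.top_ne_zero)
    have hsqrt := hmeasure.ennrpow_const (1 / 2)
    rw [ENNReal.top_mul hband, ENNReal.top_rpow_of_pos one_half_pos] at hsqrt
    simpa only [ENNReal.mul_top (ENNReal.ofReal_pos.2 hm).ne'] using
      ENNReal.Tendsto.const_mul (a := ENNReal.ofReal m) hsqrt (.inl ENNReal.top_ne_zero)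
  refine tendsto_nhds_top_mono' hlower fun n => ?_
  refine le_normXthenY_top (s := Set.Ioo (-(2 ^ n)⁻¹) 0) ?_ fun y hy => hle _ y hy.2 fun j hj => ?_
  · rw [Real.volume_Ioo]
    exact (ENNReal.ofReal_pos.2 (by simp)).ne'
  · calc -(y * 2 ^ j) = -y * 2 ^ j := by ring
      _ ≤ (2 ^ n)⁻¹ * 2 ^ n := by
        gcongr
        · linarith [hy.1]
        · exact one_le_two
        · exact (Finset.mem_Icc.1 hj).2
      _ = 1 := inv_mul_cancel₀ (by positivity)

end LowerBound

section UpperBound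

lemma IsBump.exists_norm_sum_tensorBump_le {χ : ℝ → ℝ} {a b c d : ℝ} (hχ : IsBump χ a b c d)
    {ψ : ℕ → ℝ → ℝ} (hψ : ∀ j, IsShellBump (ψ j) j) : ∃ C : ℝ≥0, ∀ (S : Finset ℕ) (p : ℝ × ℝ),
      ‖∑ j ∈ S, tensorBump χ (ψ j) j p‖ ≤ C * Real.exp (-(p.1 ^ 2 + p.2 ^ 2)) := by
  have hmass : 0 ≤ ∫ ξ, χ ξ := integral_nonneg hχ.nonneg
  refine ⟨(Real.exp 4 * (2 * ∫ ξ, χ ξ)).toNNReal, fun S p => ?_⟩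
  calc ‖∑ j ∈ S, tensorBump χ (ψ j) j p‖
      ≤ ∑ j ∈ S, ψ j p.2 * (2 * (∫ ξ, χ ξ) * Real.exp (-p.1 ^ 2)) := by
        refine norm_sum_le_of_le S fun j _ => ?_
        have hψj := (hψ j).isBump.nonneg p.2
        rw [tensorBump_eq_mul_profile, norm_mul, Complex.norm_real, Real.norm_of_nonneg hψj]
        exact mul_le_mul_of_nonneg_left (norm_profile_le hχ.integrable hχ.nonneg j p.1) hψj
    _ ≤ Real.exp 4 * Real.exp (-p.2 ^ 2) * (2 * (∫ ξ, χ ξ) * Real.exp (-p.1 ^ 2)) := by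
        rw [← Finset.sum_mul]
        exact mul_le_mul_of_nonneg_right (sum_shellBump_le hψ S p.2) (by positivity)
    _ = _ := by
        rw [Real.coe_toNNReal _ (by positivity), neg_add, Real.exp_add]
        ring

lemma norm_gaussWeighted (f : ℝ × ℝ → ℂ) (p : ℝ × ℝ) :
    ‖gaussWeighted f p‖ = Real.exp (p.1 ^ 2 + p.2 ^ 2) * ‖f p‖ := by
  rw [gaussWeighted, norm_mul, Complex.norm_real, Real.norm_of_nonneg (Real.exp_nonneg _)]

lemma normYthenX_gaussWeighted_le {f : ℝ × ℝ → ℂ} {C : ℝ≥0}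
    (hf : ∀ p, ‖f p‖ ≤ C * Real.exp (-(p.1 ^ 2 + p.2 ^ 2))) :
    normYthenX ∞ ∞ (gaussWeighted f) ≤ C := by
  simp only [normYthenX, eLpNorm_exponent_top]
  refine eLpNormEssSup_le_of_ae_enorm_bound (.of_forall fun x => ?_)
  refine eLpNormEssSup_le_of_ae_enorm_bound (.of_forall fun y => ?_)
  rw [enorm_le_coe, ← NNReal.coe_le_coe, coe_nnnorm, norm_gaussWeighted, ← le_div_iff₀'
    (Real.exp_pos _), div_eq_mul_inv, ← Real.exp_neg]
  exact hf (x, y)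

lemma normYthenX_top_two_le (f : ℝ × ℝ → ℂ) :
    normYthenX ∞ 2 f ≤ normYthenX ∞ ∞ (gaussWeighted f) * eLpNorm cauchyWeight 2 := by
  have hcauchy (x y : ℝ) : 1 ≤ cauchyWeight x * Real.exp (x ^ 2 + y ^ 2) := by
    rw [cauchyWeight, le_inv_mul_iff₀ (by positivity), mul_one]
    linarith [Real.add_one_le_exp (x ^ 2 + y ^ 2), sq_nonneg y]
  have hslice (x : ℝ) : eLpNorm (fun y => f (x, y)) ∞ ≤
      ENNReal.ofReal (cauchyWeight x) * eLpNorm (fun y => gaussWeighted f (x, y)) ∞ := by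
    refine eLpNorm_le_mul_eLpNorm_of_ae_le_mul (.of_forall fun y => ?_) ∞
    rw [norm_gaussWeighted, ← mul_assoc]
    exact le_mul_of_one_le_left (norm_nonneg _) (hcauchy x y)
  refine eLpNorm_le_mul_eLpNorm_of_ae_le_mul'' 2 continuous_cauchyWeight.aestronglyMeasurable ?_
  filter_upwards [ae_le_eLpNormEssSup (μ := volume)
    (f := fun x => eLpNorm (fun y => gaussWeighted f (x, y)) ∞)] with x hx
  rw [enorm_eq_self, Real.enorm_of_nonneg (cauchyWeight_pos x).le, mul_comm, normYthenX,
    eLpNorm_exponent_top (f := fun x => eLpNorm _ _ _)]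
  exact (hslice x).trans (mul_le_mul_right hx _)

end UpperBound

section Unboundedness

variable {χ : ℝ → ℝ} {ψ : ℕ → ℝ → ℝ} {A c d : ℝ}

lemma exists_schwartz_sum_tensorBump {a b : ℝ} (hχ : IsBump χ a b c d)
    (hψ : ∀ j, IsShellBump (ψ j) j) (S : Finset ℕ) :
    ∃ G : 𝓢(ℝ × ℝ, ℂ), ∀ p, G p = ∑ j ∈ S, tensorBump χ (ψ j) j p := by
  choose G hG using fun j => exists_schwartz_tensorBump hχ.1 hχ.hasCompactSupport
    (hψ j).isBump.1 (hψ j).isBump.hasCompactSupport j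
  exact ⟨∑ j ∈ S, G j, fun p => by simp only [sum_apply, hG]⟩

theorem IsBump.exists_schwartz_unbounded_R₁₂ (hχ : IsBump χ 0 A c d) (hcd : c < d)
    (hψ : ∀ j, IsShellBump (ψ j) j) (n₀ : ℕ) :
    ∃ g : ℕ → 𝓢(ℝ × ℝ, ℂ),
      (∀ n p, g n p = ∑ j ∈ Finset.Icc n₀ n, tensorBump χ (ψ j) j p) ∧
      (∃ C : ℝ≥0, ∀ n, normYthenX ∞ ∞ (gaussWeighted (g n)) ≤ C) ∧
      (∀ n, normXthenY 2 ∞ (R₁₂ (g n)) < ∞) ∧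
      Tendsto (fun n => normXthenY 2 ∞ (R₁₂ (g n))) atTop (𝓝 ∞) := by
  choose g hg using fun n => exists_schwartz_sum_tensorBump hχ hψ (Finset.Icc n₀ n)
  obtain ⟨C, hC⟩ := hχ.exists_norm_sum_tensorBump_le hψ
  refine ⟨g, hg, ⟨C, fun n => normYthenX_gaussWeighted_le fun p => ?_⟩,
    fun n => normXthenY_two_top_R₁₂_lt_top (g n), ?_⟩
  · rw [hg]
    exact hC _ p
  · simpa only [← hg] using hχ.tendsto_normXthenY_R₁₂ hcd hψ n₀

theorem not_exists_normXthenY_R₁₂_le_gaussWeighted :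
    ¬ ∃ C : ℝ≥0, ∀ f : 𝓢(ℝ × ℝ, ℂ),
      normXthenY 2 ∞ (R₁₂ f) ≤ C * normYthenX ∞ ∞ (gaussWeighted f) := by
  rintro ⟨D, hD⟩
  obtain ⟨χ, hχ⟩ : ∃ χ, IsBump χ 0 3 1 2 := exists_isBump one_pos (by norm_num)
  choose ψ hψ using exists_isShellBump
  obtain ⟨g, -, ⟨C, hC⟩, -, htend⟩ := hχ.exists_schwartz_unbounded_R₁₂ one_lt_two hψ 0
  have hle (n : ℕ) : normXthenY 2 ∞ (R₁₂ (g n)) ≤ D * C := (hD (g n)).trans (by gcongr; exact hC n)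
  exact ENNReal.mul_ne_top ENNReal.coe_ne_top ENNReal.coe_ne_top
    (top_le_iff.1 (le_of_tendsto' htend hle))

theorem not_exists_normXthenY_R₁₂_le_normYthenX :
    ¬ ∃ C : ℝ≥0, ∀ f : 𝓢(ℝ × ℝ, ℂ), normXthenY 2 ∞ (R₁₂ f) ≤ C * normYthenX ∞ 2 f := by
  rintro ⟨D, hD⟩
  refine not_exists_normXthenY_R₁₂_le_gaussWeighted
    ⟨D * (eLpNorm cauchyWeight 2).toNNReal, fun f => ?_⟩
  calc normXthenY 2 ∞ (R₁₂ f) ≤ D * normYthenX ∞ 2 f := hD f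
    _ ≤ D * (normYthenX ∞ ∞ (gaussWeighted f) * eLpNorm cauchyWeight 2) := by
      gcongr
      exact normYthenX_top_two_le f
    _ = _ := by
      rw [ENNReal.coe_mul, ENNReal.coe_toNNReal memLp_two_cauchyWeight.2.ne, mul_right_comm,
        mul_assoc]

end Unboundedness

end DoubleRiesz

end

theorem proposition2p1_general :
    (∀ (f : 𝓢(ℝ × ℝ, ℂ)) (p : ℝ × ℝ),
      Tendsto (fun ε : ℝ => DoubleRiesz.truncated f ε p) (𝓝[>] 0)
        (𝓝 (DoubleRiesz.R₁₂ f p))) ∧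
    (∀ {A c d : ℝ} {χ : ℝ → ℝ} {χ₁ : ℕ → ℝ → ℝ} (n₀ : ℕ), DoubleRiesz.IsBump χ 0 A c d → c < d →
      (∀ j, DoubleRiesz.IsShellBump (χ₁ j) j) →
      ∃ g : ℕ → 𝓢(ℝ × ℝ, ℂ),
        (∀ n p, g n p = ∑ j ∈ Finset.Icc n₀ n, DoubleRiesz.tensorBump χ (χ₁ j) j p) ∧
        (∃ C : ℝ≥0, ∀ n, DoubleRiesz.normYthenX ∞ ∞ (DoubleRiesz.gaussWeighted (g n)) ≤ C) ∧
        (∀ n, DoubleRiesz.normXthenY 2 ∞ (DoubleRiesz.R₁₂ (g n)) < ∞) ∧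
        Tendsto (fun n => DoubleRiesz.normXthenY 2 ∞ (DoubleRiesz.R₁₂ (g n))) atTop (𝓝 ∞)) ∧
    (¬ ∃ C : ℝ≥0, ∀ f : 𝓢(ℝ × ℝ, ℂ),
      DoubleRiesz.normXthenY 2 ∞ (DoubleRiesz.R₁₂ f) ≤
        C * DoubleRiesz.normYthenX ∞ ∞ (DoubleRiesz.gaussWeighted f)) ∧
    (¬ ∃ C : ℝ≥0, ∀ f : 𝓢(ℝ × ℝ, ℂ),
      DoubleRiesz.normXthenY 2 ∞ (DoubleRiesz.R₁₂ f) ≤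
        C * DoubleRiesz.normYthenX ∞ 2 f) :=
  ⟨fun f p => (DoubleRiesz.exists_hasCauchyDecay f).choose_spec.tendsto_truncated p,
    fun n₀ hχ hcd hχ₁ => hχ.exists_schwartz_unbounded_R₁₂ hcd hχ₁ n₀,
    DoubleRiesz.not_exists_normXthenY_R₁₂_le_gaussWeighted,
    DoubleRiesz.not_exists_normXthenY_R₁₂_le_normYthenX⟩

theorem proposition2p1 :
    -- the principal value defining `R₁₂ f` converges everywhere for every Schwartz function
    (∀ (f : 𝓢(ℝ × ℝ, ℂ)) (p : ℝ × ℝ),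
      Tendsto (fun ε : ℝ => DoubleRiesz.truncated f ε p) (𝓝[>] 0)
        (𝓝 (DoubleRiesz.R₁₂ f p))) ∧
    -- the sequence `g n`, a sum of tensor bumps
    (∃ (A : ℝ) (χ : ℝ → ℝ) (χ₁ : ℕ → ℝ → ℝ) (g : ℕ → 𝓢(ℝ × ℝ, ℂ)),
      3 ≤ A ∧ A ≤ 100 ∧
      DoubleRiesz.IsBump χ 0 A (1 / 4) (A - 1 / 4) ∧
      (∀ j : ℕ, DoubleRiesz.IsBump (χ₁ j)
        ((2 : ℝ) ^ (-(j : ℤ))) ((2 : ℝ) ^ (-(j : ℤ) + 1))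
        ((2 : ℝ) ^ (-(j : ℤ)) + (2 : ℝ) ^ (-(j : ℤ) - 10))
        ((2 : ℝ) ^ (-(j : ℤ) + 1) - (2 : ℝ) ^ (-(j : ℤ) - 10))) ∧
      (∀ (n : ℕ) (p : ℝ × ℝ),
        g n p = ∑ j ∈ Finset.Icc 100 n, DoubleRiesz.tensorBump χ (χ₁ j) j p) ∧
      (∃ C : ℝ≥0, ∀ n : ℕ,
        DoubleRiesz.normYthenX ∞ ∞ (DoubleRiesz.gaussWeighted (g n)) ≤ C) ∧
      (∀ n : ℕ, DoubleRiesz.normXthenY 2 ∞ (DoubleRiesz.R₁₂ (g n)) < ∞) ∧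
      Tendsto (fun n : ℕ => DoubleRiesz.normXthenY 2 ∞ (DoubleRiesz.R₁₂ (g n)))
        atTop (𝓝 ∞)) ∧
    -- consequently both endpoint estimates fail
    (¬ ∃ C : ℝ≥0, ∀ f : 𝓢(ℝ × ℝ, ℂ),
      DoubleRiesz.normXthenY 2 ∞ (DoubleRiesz.R₁₂ f) ≤
        C * DoubleRiesz.normYthenX ∞ ∞ (DoubleRiesz.gaussWeighted f)) ∧
    (¬ ∃ C : ℝ≥0, ∀ f : 𝓢(ℝ × ℝ, ℂ),
      DoubleRiesz.normXthenY 2 ∞ (DoubleRiesz.R₁₂ f) ≤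
        C * DoubleRiesz.normYthenX ∞ 2 f) := by
  obtain ⟨hpv, hfamily, hgauss, hmixed⟩ := proposition2p1_general
  obtain ⟨χ, hχ⟩ : ∃ χ, DoubleRiesz.IsBump χ 0 3 (1 / 4) (3 - 1 / 4) :=
    DoubleRiesz.exists_isBump (by norm_num) (by norm_num)
  choose χ₁ hχ₁ using DoubleRiesz.exists_isShellBump
  obtain ⟨g, hg⟩ := hfamily 100 hχ (by norm_num) hχ₁
  exact ⟨hpv, ⟨3, χ, χ₁, g, le_rfl, by norm_num, hχ, hχ₁, hg⟩, hgauss, hmixed⟩
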